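/- **The puzzle.** In the Magnetic Tower of Hanoi there are three posts $S$ (source), $I$ (intermediate), $D$ (destination) and $N$ disks of distinct sizes, numbered $1,\dots,N$ from the biggest to the smallest, each with one red and one blue face. Each post is pre-coloured Red (R), Blue (B) or is Neutral (N); a pre-colouring is written in the order $(S,I,D)$. At the start all disks are on $S$, stacked in decreasing order of size, with red faces up. A move takes the top disk of a post, flips it, and puts it on top of another post, subject to: the disk under it, if any, is larger (size rule); the two faces coming into contact have different colours, i.e. all disks on one post show the same colour upwards (magnetic rule); on a post pre-coloured Red (Blue) a disk must come to lie with its red (blue) face up. The puzzle is solved when all disks are on $D$ with blue faces up. A sequence of legal moves that solves the puzzle is *optimal* if no solving sequence has fewer moves. **The algorithms.** $A(n;s,d,i)$ denotes the list of moves by which algorithm $A$ carries the $n$ smallest disks from post $s$ to post $d$ using post $i$. In it, $[1\colon s\to d]$ and $[2\colon s\to d]$ are the single moves from $s$ to $d$ of the biggest, respectively second biggest, of these $n$ disks. Every list is empty for $n=0$. For $n\ge 1$: - $\mathrm{RBB}_{1000}(n;s,d,i)$: $\mathrm{RBB}_{1000}(n-1;s,i,d)$, $[1\colon s\to d]$,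 $\mathrm{RRB}_{1000}(n-1;i,s,d)$, $\mathrm{RBB}_{1000}(n-1;s,d,i)$. - $\mathrm{RRB}_{1000}(n;s,d,i)$: $\mathrm{RRB}_{1000}(n-1;s,d,i)$, $\mathrm{RBB}_{1000}(n-1;d,i,s)$, $[1\colon s\to d]$, $\mathrm{RRB}_{1000}(n-1;i,d,s)$. - $\mathrm{RBN}_{909}(n;s,d,i)$: $\mathrm{RNB}_{727}(n-1;s,i,d)$, $[1\colon s\to d]$, $\mathrm{RRB}_{1000}(n-1;i,s,d)$, $\mathrm{RBB}_{1000}(n-1;s,d,i)$. - $\mathrm{NRB}_{909}(n;s,d,i)$: $\mathrm{RRB}_{1000}(n-1;s,d,i)$, $\mathrm{RBB}_{1000}(n-1;d,i,s)$, $[1\colon s\to d]$, $\mathrm{BNR}_{727}(n-1;i,d,s)$. The lists of $\mathrm{RNB}_{727}$, $\mathrm{BNR}_{727}$, $\mathrm{RNN}_{636}$, $\mathrm{NNB}_{636}$ are $[1\colon s\to d]$ for $n=1$, and for $n\ge 2$: - $\mathrm{RNB}_{727}(n;s,d,i)$: $\mathrm{RBN}_{909}(n-1;s,i,d)$, $[1\colon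 s\to d]$, $\mathrm{RRB}_{1000}(n-2;i,s,d)$, $\mathrm{RBB}_{1000}(n-2;s,d,i)$, $[2\colon i\to s]$, $\mathrm{RBN}_{909}(n-2;d,i,s)$, $[2\colon s\to d]$, $\mathrm{NRB}_{909}(n-2;i,d,s)$. - $\mathrm{BNR}_{727}(n;s,d,i)$: $\mathrm{RBN}_{909}(n-2;s,i,d)$, $[2\colon s\to d]$, $\mathrm{NRB}_{909}(n-2;i,s,d)$, $[2\colon d\to i]$, $\mathrm{RRB}_{1000}(n-2;s,d,i)$, $\mathrm{RBB}_{1000}(n-2;d,i,s)$, $[1\colon s\to d]$, $\mathrm{NRB}_{909}(n-1;i,d,s)$. - $\mathrm{RNN}_{636}(n;s,d,i)$: as $\mathrm{RNB}_{727}$, with the first step replaced by $\mathrm{RNN}_{636}(n-1;s,i,d)$. - $\mathrm{NNB}_{636}(n;s,d,i)$: as $\mathrm{BNR}_{727}$, with the last step replaced by $\mathrm{NNB}_{636}(n-1;i,d,s)$. Let $S_{1000}(N)$, $S_{909}(N)$, $S_{636}(N)$ be the numbers of moves of $\mathrm{RBB}_{1000}$, $\mathrm{RBN}_{909}$, $\mathrm{RNN}_{636}$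 applied to $(N;S,D,I)$, and $P_{1000}(k)$, $P_{909}(k)$, $P_{636}(k)$ the numbers of those moves that move disk number $k$, when $N=k$. **Theorem.** 1. For every $N$, $\mathrm{RNN}_{636}(N;S,D,I)$ is an optimal solution of the $N$-disk puzzle with pre-colouring RNN, and $\mathrm{NNB}_{636}(N;S,D,I)$ is an optimal solution of the $N$-disk puzzle with pre-colouring NNB. 2. For every $N$, $\mathrm{NNB}_{636}$, $\mathrm{NRB}_{909}$, $\mathrm{RRB}_{1000}$ make respectively $S_{636}(N)$, $S_{909}(N)$, $S_{1000}(N)$ moves as well. For $1\le k\le N$, in the $N$-disk puzzle disk number $k$ is moved $P_{636}(k)$ times by each of $\mathrm{RNN}_{636}$, $\mathrm{NNB}_{636}$, $P_{909}(k)$ times by each of $\mathrm{RBN}_{909}$, $\mathrm{NRB}_{909}$, and $P_{1000}(k)$ times by each of $\mathrm{RBB}_{1000}$, $\mathrm{RRB}_{1000}$, independently of $N$. 3. $S_{636}(1)=1$, $S_{636}(2)=4$, and for all $N\ge 1$ $$S_{636}(N+1)=S_{636}(N)+2\,S_{909}(N-1)+2\,S_{1000}(N-1)+3 .$$ 4.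 $P_{636}(1)=1$, $P_{636}(2)=3$, and for all $k\ge 2$ $$P_{636}(k+1)=P_{636}(k)+2\,P_{909}(k-1)+2\,P_{1000}(k-1).$$ 5. The duration limit is $\lim_{N\to\infty} S_{636}(N)/S_{1000}(N)=7/11$. -/

import Mathlib

namespace MToH

/-- The three posts: Source, Intermediate, Destination. -/
inductive Post where
  | S | I | D
  deriving DecidableEq

/-- The two colours; every disk has one face of each colour. -/
inductive Colour where
  | red | blue
  deriving DecidableEq

/-- The other colour. -/
def Colour.flip : Colour → Colour
  | .red => .blue
  | .blue => .red

/-- A pre-colouring of the posts; `none` is a Neutral post. -/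
abbrev PreColouring := Post → Option Colour

/-- The pre-colouring written `abc` in (Source, Intermediate, Destination) order. -/
def preColouring (a b c : Option Colour) : PreColouring
  | .S => a
  | .I => b
  | .D => c

/-- Source Red, Intermediate and Destination Neutral. -/
def RNN : PreColouring := preColouring (some .red) none none

/-- Source and Intermediate Neutral, Destination Blue. -/
def NNB : PreColouring := preColouring none none (some .blue)

/-- A Tower-State of `N` disks. Disks are labelled by size, `0` the smallest and `N - 1` the
biggest (so the disk which is number `k` when counted from the biggest, numbered `1`, has label
`N - k`). Recorded are the post on which each disk lies and the colour of its upper face; on each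
post the disks are stacked in decreasing order of size. -/
abbrev State (N : ℕ) := Fin N → Post × Colour

/-- `k` is the top (that is, the smallest) disk on the post `p`. -/
def IsTop {N : ℕ} (c : State N) (k : Fin N) (p : Post) : Prop :=
  (c k).1 = p ∧ ∀ l : Fin N, (c l).1 = p → k ≤ l

/-- The instruction to carry the disk with size label `disk` from `src` to `dst`. -/
structure Move where
  disk : ℕ
  src : Post
  dst : Post
  deriving DecidableEq

/-- `Step pre c m c'`: under the pre-colouring `pre`, the move `m` is allowed in the state `c`
and leads to the state `c'`. The disk moved is the top disk of `m.src`; it is flipped and put on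
top of another post `m.dst`.
* Size rule: it is smaller than the disk on which it is put.
* Magnetic rule: the two faces that come into contact have different colours. The lower face of
  the flipped disk has the colour that its upper face had before the move.
* On a post pre-coloured `q`, a disk lies with colour `q` up. -/
def Step {N : ℕ} (pre : PreColouring) (c : State N) (m : Move) (c' : State N) : Prop :=
  ∃ k : Fin N, (k : ℕ) = m.disk ∧ IsTop c k m.src ∧ m.src ≠ m.dst ∧
    (∀ l : Fin N, IsTop c l m.dst → k < l ∧ (c l).2 ≠ (c k).2) ∧
    (∀ q : Colour, pre m.dst = some q → (c k).2.flip = q) ∧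
    c' = Function.update c k (m.dst, (c k).2.flip)

/-- `Run pre c L c'`: performing the moves of `L` one after the other, all of them allowed, leads
from the state `c` to the state `c'`. -/
def Run {N : ℕ} (pre : PreColouring) : State N → List Move → State N → Prop
  | c, [], c' => c = c'
  | c, m :: L, c' => ∃ c₁ : State N, Step pre c m c₁ ∧ Run pre c₁ L c'

/-- `L` solves the `N`-disk puzzle with the pre-colouring `pre`: it carries the tower from the
Source post, all disks Red facing up, to the Destination post, all disks Blue facing up. -/
def Solves (pre : PreColouring) (N : ℕ) (L : List Move) : Prop :=
  Run (N := N) pre (fun _ => (.S, .red)) L (fun _ => (.D, .blue))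

/-- `L` solves the puzzle, and no solution has fewer moves. -/
def IsOptimal (pre : PreColouring) (N : ℕ) (L : List Move) : Prop :=
  Solves pre N L ∧ ∀ L' : List Move, Solves pre N L' → L.length ≤ L'.length

/-! The algorithms. Each is called with a number `n` of disks and the posts `s` (source),
`d` (destination), `i` (intermediate), and moves the `n` smallest disks from `s` to `d`.
In a call with `n` disks the biggest of them has size label `n - 1`, the next one `n - 2`. -/

mutual

/-- The "1000" algorithm for the pre-colouring RBB. -/
def SRBB1000 : ℕ → Post → Post → Post → List Move
  | 0, _, _, _ => []
  | n + 1, s, d, i =>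
    SRBB1000 n s i d ++ [⟨n, s, d⟩] ++ SRRB1000 n i s d ++ SRBB1000 n s d i

/-- The "1000" algorithm for the pre-colouring RRB. -/
def SRRB1000 : ℕ → Post → Post → Post → List Move
  | 0, _, _, _ => []
  | n + 1, s, d, i =>
    SRRB1000 n s d i ++ SRBB1000 n d i s ++ [⟨n, s, d⟩] ++ SRRB1000 n i d s

end

mutual

/-- The "909" algorithm for the pre-colouring RBN. -/
def SRBN909 : ℕ → Post → Post → Post → List Move
  | 0, _, _, _ => []
  | n + 1, s, d, i =>
    SRNB727 n s i d ++ [⟨n, s, d⟩] ++ SRRB1000 n i s d ++ SRBB1000 n s d i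

/-- The "909" algorithm for the pre-colouring NRB. -/
def SNRB909 : ℕ → Post → Post → Post → List Move
  | 0, _, _, _ => []
  | n + 1, s, d, i =>
    SRRB1000 n s d i ++ SRBB1000 n d i s ++ [⟨n, s, d⟩] ++ SBNR727 n i d s

/-- The "727" algorithm for the pre-colouring RNB. -/
def SRNB727 : ℕ → Post → Post → Post → List Move
  | 0, _, _, _ => []
  | 1, s, d, _ => [⟨0, s, d⟩]
  | n + 2, s, d, i =>
    SRBN909 (n + 1) s i d ++ [⟨n + 1, s, d⟩] ++
      SRRB1000 n i s d ++ SRBB1000 n s d i ++ [⟨n, i, s⟩] ++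
      SRBN909 n d i s ++ [⟨n, s, d⟩] ++ SNRB909 n i d s

/-- The time-reversed "727" algorithm (also for the pre-colouring RNB). -/
def SBNR727 : ℕ → Post → Post → Post → List Move
  | 0, _, _, _ => []
  | 1, s, d, _ => [⟨0, s, d⟩]
  | n + 2, s, d, i =>
    SRBN909 n s i d ++ [⟨n, s, d⟩] ++ SNRB909 n i s d ++ [⟨n, d, i⟩] ++
      SRRB1000 n s d i ++ SRBB1000 n d i s ++
      [⟨n + 1, s, d⟩] ++ SNRB909 (n + 1) i d s

end

/-- The "636" algorithm for the pre-colouring RNN. -/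
def SRNN636 : ℕ → Post → Post → Post → List Move
  | 0, _, _, _ => []
  | 1, s, d, _ => [⟨0, s, d⟩]
  | n + 2, s, d, i =>
    SRNN636 (n + 1) s i d ++ [⟨n + 1, s, d⟩] ++
      SRRB1000 n i s d ++ SRBB1000 n s d i ++ [⟨n, i, s⟩] ++
      SRBN909 n d i s ++ [⟨n, s, d⟩] ++ SNRB909 n i d s

/-- The "636" algorithm for the pre-colouring NNB. -/
def SNNB636 : ℕ → Post → Post → Post → List Move
  | 0, _, _, _ => []
  | 1, s, d, _ => [⟨0, s, d⟩]
  | n + 2, s, d, i =>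
    SRBN909 n s i d ++ [⟨n, s, d⟩] ++ SNRB909 n i s d ++ [⟨n, d, i⟩] ++
      SRRB1000 n s d i ++ SRBB1000 n d i s ++
      [⟨n + 1, s, d⟩] ++ SNNB636 (n + 1) i d s

/-- The total number of moves of an algorithm on the `N`-disk puzzle. -/
def totalMoves (alg : ℕ → Post → Post → Post → List Move) (N : ℕ) : ℕ :=
  (alg N .S .D .I).length

/-- The number of moves of disk number `k` (`1 ≤ k ≤ N`; number `1` is the biggest disk) when an
algorithm is applied to the `N`-disk puzzle. -/
def diskMoves (alg : ℕ → Post → Post → Post → List Move) (N k : ℕ) : ℕ :=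
  ((alg N .S .D .I).filter (fun m => m.disk = N - k)).length

def S1000 : ℕ → ℕ := totalMoves SRBB1000
def S909 : ℕ → ℕ := totalMoves SRBN909
def S636 : ℕ → ℕ := totalMoves SRNN636

/-- The moves of disk number `k`, read off from the `k`-disk puzzle (and likewise below). -/
def P1000 (k : ℕ) : ℕ := diskMoves SRBB1000 k k
def P909 (k : ℕ) : ℕ := diskMoves SRBN909 k k
def P636 (k : ℕ) : ℕ := diskMoves SRNN636 k k

end MToH

-- While the biggest disk rests, the smaller disks cannot tell it from a pre-coloured post: any of
-- them may lie on it, and it only dictates the colour shown there (`pin`). It can move only when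
-- all smaller disks form a tower on the third post. So questions about n + 1 disks reduce to
-- questions about towers of n disks in pinned pre-colourings.
--
-- Legality of the algorithms (`carries_1000`, `carries_909_727`, `carries_SRNN636`,
-- `carries_SNNB636`) follows by induction: each recursive call runs under a resting biggest disk
-- (`Run.lift`).
--
-- For optimality, lower bounds are proved for the distances between all towers, not just the
-- required pair, in three kinds of colouring: three coloured posts (`farCol`), one neutral post
-- beside a red and a blue one (`farNeutral`), two neutral posts (`farNeutral₂`). Pinning leads from
-- each kind to itself or to an earlier one; red-red-neutral, which also arises, acts as
-- red-red-blue (`Run.pin_of_neutral`). By `Run.restrict` a run of n + 1 disks is a walk on the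
-- finitely many arrangements "biggest disk, tower of the others", each edge costing a distance for
-- n disks plus one. A potential that drops along no edge by more than its cost bounds the length
-- from below (`far_of_potential`). The potentials are explicit tables, and checking them leaves
-- linear inequalities among the distances at level n (`d_inequalities`, `e_inequalities`). The
-- bound for RNN is `eDiff`; the move count obeys the same recurrence, so both bounds meet. NNB has
-- the same bound because runs are reversible and the bounds are stated up to renaming.
--
-- Moves are counted once for an arbitrary predicate on disk labels: the constant predicate gives
-- totals, a single label gives the moves of one disk. For the limit, `dAdj n` is (3 ^ n - 1) / 2,
-- while `eDiff n` is 7/22 of 3 ^ n up to O(2 ^ n).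

namespace MToH

-- Pinned pre-colourings and states with an added biggest disk.

/-- The pre-colouring `pre` allows a disk to lie on the post `x.1` with colour `x.2` up. -/
def Allows (pre : PreColouring) (x : Post × Colour) : Prop :=
  pre x.1 = none ∨ pre x.1 = some x.2

instance (pre : PreColouring) (x : Post × Colour) : Decidable (Allows pre x) :=
  inferInstanceAs (Decidable (_ ∨ _))

/-- The pre-colouring seen by the smaller disks while a bigger disk lies on `x.1` with colour
`x.2` up. -/
def pin (pre : PreColouring) (x : Post × Colour) : PreColouring :=
  Function.update pre x.1 (some x.2)

/-- All disks on one post with the same colour up. -/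
def tower (n : ℕ) (x : Post × Colour) : State n := fun _ => x

/-- Put a new biggest disk under a state. -/
def ext {n : ℕ} (c : State n) (x : Post × Colour) : State (n + 1) :=
  Fin.snoc (α := fun _ => Post × Colour) c x

/-- The disks obey the pre-colouring, and those on one post show the same colour. -/
def Valid {n : ℕ} (pre : PreColouring) (c : State n) : Prop :=
  (∀ k, Allows pre (c k)) ∧ ∀ k l, (c k).1 = (c l).1 → (c k).2 = (c l).2

@[simp] theorem Colour.flip_flip (a : Colour) : a.flip.flip = a := by cases a <;> rfl

theorem Colour.flip_ne (a : Colour) : a.flip ≠ a := by cases a <;> decide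

theorem Colour.eq_flip_of_ne {a b : Colour} (h : a ≠ b) : b.flip = a := by
  cases a <;> cases b <;> first | rfl | exact absurd rfl h

theorem allows_iff {pre : PreColouring} {x : Post × Colour} :
    Allows pre x ↔ ∀ q, pre x.1 = some q → x.2 = q := by
  unfold Allows
  cases pre x.1 with
  | none => simp
  | some q => simp [eq_comm]

theorem allows_pin_self (pre : PreColouring) (x : Post × Colour) : Allows (pin pre x) x := by
  right; simp [pin]

theorem allows_pin_of_ne {pre : PreColouring} {x y : Post × Colour} (h : y.1 ≠ x.1) :
    Allows (pin pre x) y ↔ Allows pre y := by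
  simp [Allows, pin, Function.update_of_ne h]

theorem Allows.pin {pre : PreColouring} {x y : Post × Colour} (hy : Allows pre y)
    (h : y.1 = x.1 → y.2 = x.2) : Allows (pin pre x) y := by
  by_cases hp : y.1 = x.1
  · rw [show y = x from Prod.ext hp (h hp)]; exact allows_pin_self _ _
  · exact (allows_pin_of_ne hp).2 hy

@[simp] theorem ext_castSucc {n : ℕ} (c : State n) (x : Post × Colour) (k : Fin n) :
    ext c x k.castSucc = c k := by simp [ext]

@[simp] theorem ext_last {n : ℕ} (c : State n) (x : Post × Colour) :
    ext c x (Fin.last n) = x := by simp [ext]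

theorem tower_succ (n : ℕ) (x : Post × Colour) : tower (n + 1) x = ext (tower n x) x := by
  funext k
  refine Fin.lastCases ?_ (fun k => ?_) k <;> simp [tower]

theorem ext_update {n : ℕ} (c : State n) (x y : Post × Colour) (k : Fin n) :
    Function.update (ext c x) k.castSucc y = ext (Function.update c k y) x := by
  simp [ext]

theorem ext_update_last {n : ℕ} (c : State n) (x y : Post × Colour) :
    Function.update (ext c x) (Fin.last n) y = ext c y := by
  funext k
  refine Fin.lastCases (by simp) (fun k => ?_) k
  rw [Function.update_of_ne (Fin.castSucc_lt_last k).ne, ext_castSucc, ext_castSucc]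

theorem ext_inj {n : ℕ} {c c' : State n} {x y : Post × Colour} (h : ext c x = ext c' y) :
    c = c' ∧ x = y :=
  ⟨funext fun k => by simpa using congrFun h k.castSucc, by simpa using congrFun h (Fin.last n)⟩

theorem valid_tower {pre : PreColouring} {n : ℕ} {x : Post × Colour} (h : Allows pre x) :
    Valid pre (tower n x) :=
  ⟨fun _ => h, fun _ _ _ => rfl⟩

theorem valid_ext_tower {pre : PreColouring} {n : ℕ} {x y : Post × Colour} (hx : Allows pre x)
    (hy : Allows (pin pre x) y) : Valid pre (ext (tower n y) x) := by
  have hxy : y.1 = x.1 → y.2 = x.2 := by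
    intro h
    have := allows_iff.1 hy x.2 (by simp [pin, h])
    exact this
  have hy' : Allows pre y := by
    by_cases h : y.1 = x.1
    · rwa [show y = x from Prod.ext h (hxy h)]
    · exact (allows_pin_of_ne h).1 hy
  constructor
  · intro k
    refine Fin.lastCases ?_ (fun k => ?_) k
    · simpa using hx
    · simpa [tower] using hy'
  · intro k l
    refine Fin.lastCases ?_ (fun k => ?_) k <;> refine Fin.lastCases ?_ (fun l => ?_) l
    · simp
    · simpa [tower] using fun h => (hxy h.symm).symm
    · simpa [tower] using hxy
    · simp [tower]

-- Legal moves: invariants, time reversal and renaming.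

theorem exists_isTop {n : ℕ} (c : State n) (l : Fin n) : ∃ k, IsTop c k (c l).1 ∧ k ≤ l := by
  obtain ⟨k, hk, hmin⟩ := (Finset.univ.filter fun k => (c k).1 = (c l).1).exists_min_image id
    ⟨l, by simp⟩
  refine ⟨k, ⟨by simpa using hk, fun j hj => hmin j (by simpa using hj)⟩, hmin l (by simp)⟩

theorem Valid.restrict {pre : PreColouring} {n : ℕ} {c : State n} {x : Post × Colour}
    (h : Valid pre (ext c x)) : Valid (pin pre x) c := by
  refine ⟨fun k => (?_ : Allows pre (c k)).pin fun e => ?_, fun k l e => ?_⟩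
  · simpa using h.1 k.castSucc
  · simpa using h.2 k.castSucc (Fin.last n) (by simpa using e)
  · simpa using h.2 k.castSucc l.castSucc (by simpa using e)

/-- The magnetic rule compares the moved disk with the top disk of its new post only; validity lets
that top disk speak for the whole post. -/
theorem Valid.step {pre : PreColouring} {n : ℕ} {c c' : State n} {m : Move} (hv : Valid pre c)
    (h : Step pre c m c') : Valid pre c' := by
  obtain ⟨k, -, hk, hne, hl, hp, rfl⟩ := h
  have hcol : ∀ l, (c l).1 = m.dst → (c k).2.flip = (c l).2 := by
    intro l hld
    obtain ⟨j, hj, -⟩ := exists_isTop c l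
    rw [hld] at hj
    rw [← hv.2 j l (hj.1.trans hld.symm)]
    exact Colour.eq_flip_of_ne (hl j hj).2
  constructor
  · intro l
    by_cases hlk : l = k
    · subst hlk; simpa [allows_iff] using hp
    · simpa [hlk] using hv.1 l
  · intro l j
    by_cases hlk : l = k <;> by_cases hjk : j = k
    · subst hlk; subst hjk; simp
    · subst hlk; simpa [hjk] using fun e => hcol j e.symm
    · subst hjk; simpa [hlk] using fun e => (hcol l e).symm
    · simpa [hlk, hjk] using hv.2 l j

/-- Flipping is an involution. Validity supplies what the backward move needs: the old post accepts
the old colour, and the disks left there still show it. -/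
theorem Step.reverse {pre : PreColouring} {n : ℕ} {c c' : State n} {m : Move} (hv : Valid pre c)
    (h : Step pre c m c') : Step pre c' ⟨m.disk, m.dst, m.src⟩ c := by
  obtain ⟨k, hkm, hk, hne, hl, hp, rfl⟩ := h
  refine ⟨k, hkm, ⟨by simp, fun l => ?_⟩, hne.symm, fun l hlt => ?_, ?_, ?_⟩
  · by_cases hlk : l = k
    · exact fun _ => hlk.ge
    · intro e
      simp only [Function.update_of_ne hlk] at e
      obtain ⟨j, hj, hjl⟩ := exists_isTop c l
      rw [e] at hj
      exact (hl j hj).1.le.trans hjl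
  · have hlk : l ≠ k := by
      rintro rfl
      exact hne (by simpa using hlt.1.symm)
    have hls : (c l).1 = m.src := by simpa [hlk] using hlt.1
    refine ⟨lt_of_le_of_ne (hk.2 l hls) (Ne.symm hlk), ?_⟩
    simp only [Function.update_of_ne hlk, Function.update_self]
    rw [hv.2 l k (hls.trans hk.1.symm)]
    exact (Colour.flip_ne _).symm
  · simp only [Function.update_self, Colour.flip_flip]
    intro q hq
    exact allows_iff.1 (hv.1 k) q (by rw [hk.1]; exact hq)
  · simp only [Function.update_self, Colour.flip_flip, Function.update_idem]
    rw [← hk.1]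
    exact (Function.update_eq_self k c).symm

theorem Run.append {pre : PreColouring} {n : ℕ} {c₂ c₃ : State n} {L' : List Move} :
    ∀ {L : List Move} {c₁ : State n}, Run pre c₁ L c₂ → Run pre c₂ L' c₃ →
      Run pre c₁ (L ++ L') c₃
  | [], _, h, h' => by cases h; exact h'
  | _ :: _, _, ⟨c, hs, h⟩, h' => ⟨c, hs, h.append h'⟩

theorem Run.reverse {pre : PreColouring} {n : ℕ} {c' : State n} :
    ∀ {L : List Move} {c : State n}, Valid pre c → Run pre c L c' →
      ∃ L', L'.length = L.length ∧ Run pre c' L' c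
  | [], _, _, h => ⟨[], rfl, Eq.symm h⟩
  | m :: _, c, hv, ⟨_, hs, h⟩ => by
    obtain ⟨L', hL', hr⟩ := h.reverse (hv.step hs)
    exact ⟨L' ++ [⟨m.disk, m.dst, m.src⟩], by simp [hL'], hr.append ⟨c, hs.reverse hv, rfl⟩⟩

/-- Renaming the posts and the colours. -/
def relabel {n : ℕ} (f : Post → Post) (g : Colour → Colour) (c : State n) : State n :=
  fun k => (f (c k).1, g (c k).2)

theorem Step.relabel {pre pre' : PreColouring} {n : ℕ} {c c' : State n} {m : Move}
    {f : Post → Post} {g : Colour → Colour} (hf : f.Injective)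
    (hg : ∀ a, g a.flip = (g a).flip) (hpre : ∀ p, pre' (f p) = (pre p).map g)
    (h : Step pre c m c') :
    Step pre' (relabel f g c) ⟨m.disk, f m.src, f m.dst⟩ (relabel f g c') := by
  have hgi : g.Injective := by
    intro a b hab
    by_contra hne
    have := Colour.eq_flip_of_ne hne
    rw [← this, hg] at hab
    exact Colour.flip_ne _ hab
  have htop : ∀ l p, IsTop (MToH.relabel f g c) l (f p) ↔ IsTop c l p := by
    intro l p
    simp [IsTop, MToH.relabel, hf.eq_iff]
  obtain ⟨k, hkm, hk, hne, hl, hp, rfl⟩ := h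
  refine ⟨k, hkm, (htop _ _).2 hk, hf.ne hne, fun l hlt => ?_, ?_, ?_⟩
  · have := hl l ((htop _ _).1 hlt)
    exact ⟨this.1, hgi.ne this.2⟩
  · intro q hq
    rw [hpre, Option.map_eq_some_iff] at hq
    obtain ⟨r, hr, rfl⟩ := hq
    simp only [MToH.relabel]
    rw [← hg, hp r hr]
  · funext l
    by_cases hlk : l = k
    · subst hlk; simp [MToH.relabel, hg]
    · simp [MToH.relabel, hlk]

theorem Run.relabel {pre pre' : PreColouring} {n : ℕ} {c' : State n}
    {f : Post → Post} {g : Colour → Colour} (hf : f.Injective)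
    (hg : ∀ a, g a.flip = (g a).flip) (hpre : ∀ p, pre' (f p) = (pre p).map g) :
    ∀ {L : List Move} {c : State n}, Run pre c L c' →
      ∃ L', L'.length = L.length ∧ Run pre' (relabel f g c) L' (relabel f g c')
  | [], _, h => ⟨[], rfl, congrArg _ h⟩
  | _ :: _, _, ⟨_, hs, h⟩ => by
    obtain ⟨L', hL', hr⟩ := h.relabel hf hg hpre
    exact ⟨_ :: L', by simp [hL'], _, hs.relabel hf hg hpre, hr⟩

-- The smaller disks and the biggest one: lifting and splitting runs.

theorem Step.lift {pre : PreColouring} {n : ℕ} {c c' : State n} {m : Move} {x : Post × Colour}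
    (hx : Allows pre x) (h : Step (pin pre x) c m c') : Step pre (ext c x) m (ext c' x) := by
  obtain ⟨k, hkm, hk, hne, hl, hp, rfl⟩ := h
  refine ⟨k.castSucc, by simpa using hkm, ⟨by simpa using hk.1, fun l => ?_⟩, hne, fun l => ?_,
    ?_, ?_⟩
  · refine Fin.lastCases (fun _ => Fin.le_last _) (fun l => ?_) l
    simpa using hk.2 l
  · refine Fin.lastCases (fun hlt => ?_) (fun l hlt => ?_) l
    · refine ⟨Fin.castSucc_lt_last k, ?_⟩
      -- The pin makes the arriving disk show the colour of the biggest disk, so the two faces in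
      -- contact differ.
      have := hp x.2 (by simp [pin, ← hlt.1])
      simp only [ext_last, ext_castSucc]
      rw [← this]
      exact Colour.flip_ne _
    · have : IsTop c l m.dst :=
        ⟨by simpa using hlt.1, fun j hj => by simpa using hlt.2 j.castSucc (by simpa using hj)⟩
      simpa using hl l this
  · intro q hq
    rw [ext_castSucc]
    by_cases hd : m.dst = x.1
    · rw [hp x.2 (by simp [pin, hd])]
      exact allows_iff.1 hx q (by rw [← hd]; exact hq)
    · exact hp q (by rw [pin, Function.update_of_ne hd]; exact hq)
  · rw [ext_update, ext_castSucc]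

theorem Run.lift {pre : PreColouring} {n : ℕ} {c' : State n} {x : Post × Colour}
    (hx : Allows pre x) :
    ∀ {L : List Move} {c : State n}, Run (pin pre x) c L c' → Run pre (ext c x) L (ext c' x)
  | [], _, h => congrArg (ext · x) h
  | _ :: _, _, ⟨_, hs, h⟩ => ⟨_, hs.lift hx, h.lift hx⟩

theorem step_biggest {pre : PreColouring} {n : ℕ} {p p' r : Post} {a e : Colour}
    (h1 : p ≠ p') (h2 : r ≠ p) (h3 : r ≠ p') (ha : Allows pre (p', a.flip)) :
    Step pre (ext (tower n (r, e)) (p, a)) ⟨n, p, p'⟩ (ext (tower n (r, e)) (p', a.flip)) := by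
  refine ⟨Fin.last n, rfl, ⟨by simp, fun l => ?_⟩, h1, fun l hl => ?_, ?_, ?_⟩
  · refine Fin.lastCases (fun _ => le_rfl) (fun l hl => ?_) l
    simp [tower, h2] at hl
  · revert hl
    refine Fin.lastCases (fun hl => ?_) (fun l hl => ?_) l
    · have := hl.1
      simp [h1] at this
    · have := hl.1
      simp [tower, h3] at this
  · simpa using allows_iff.1 ha
  · rw [ext_update_last, ext_last]

/-- If the biggest disk moves, no smaller disk can lie on the post it leaves or on the one it
reaches, so all of them are on the third post, with one colour by validity. Otherwise the move is
legal for the smaller disks alone. -/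
theorem Step.restrict {pre : PreColouring} {n : ℕ} {c : State n} {c₁ : State (n + 1)} {m : Move}
    {x : Post × Colour} (hv : Valid pre (ext c x)) (h : Step pre (ext c x) m c₁) :
    (∃ c', c₁ = ext c' x ∧ Step (pin pre x) c m c') ∨
    ∃ p' r e, x.1 ≠ p' ∧ x.1 ≠ r ∧ p' ≠ r ∧ Allows pre (p', x.2.flip) ∧
      Allows (pin pre x) (r, e) ∧ c = tower n (r, e) ∧
      c₁ = ext (tower n (r, e)) (p', x.2.flip) := by
  obtain ⟨k, hkm, hk, hne, hl, hp, rfl⟩ := h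
  revert hkm hk hl hp
  refine Fin.lastCases ?_ (fun k => ?_) k
  · intro hkm hk hl hp
    right
    simp only [ext_last] at hp
    have hx : x.1 = m.src := by simpa using hk.1
    have hsrc : ∀ l, (c l).1 ≠ m.src := by
      intro l hls
      have := hk.2 l.castSucc (by simpa using hls)
      exact absurd this (not_le.2 (Fin.castSucc_lt_last l))
    have hdst : ∀ l, (c l).1 ≠ m.dst := by
      intro l hld
      obtain ⟨j, hj, -⟩ := exists_isTop (ext c x) l.castSucc
      rw [ext_castSucc, hld] at hj
      exact absurd (hl j hj).1 (not_lt.2 (Fin.le_last j))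
    obtain ⟨r, hr1, hr2, hr3⟩ : ∃ r, m.src ≠ r ∧ m.dst ≠ r ∧
        ∀ p, p ≠ m.src → p ≠ m.dst → p = r := by
      revert hne
      generalize m.src = s
      generalize m.dst = d
      rcases s with _ | _ | _ <;> rcases d with _ | _ | _ <;> intro hne <;>
        first
        | exact absurd rfl hne
        | exact ⟨.S, by decide, by decide, fun p => by cases p <;> simp⟩
        | exact ⟨.I, by decide, by decide, fun p => by cases p <;> simp⟩
        | exact ⟨.D, by decide, by decide, fun p => by cases p <;> simp⟩
    obtain ⟨e, he, hc⟩ : ∃ e, Allows (pin pre x) (r, e) ∧ c = tower n (r, e) := by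
      -- With no smaller disk there is no colour to read off, so any colour allowed on `r` serves.
      rcases n with _ | n
      · have : ∃ e, Allows (pin pre x) (r, e) := by
          cases h : pin pre x r with
          | none => exact ⟨.red, Or.inl h⟩
          | some e => exact ⟨e, Or.inr h⟩
        exact ⟨this.choose, this.choose_spec, funext fun k => k.elim0⟩
      · have h0 : ∀ l, (c l).1 = r := fun l => hr3 _ (hsrc l) (hdst l)
        have hv' := hv.restrict
        refine ⟨(c 0).2, ?_, funext fun l => Prod.ext (h0 l) (hv'.2 l 0 (by rw [h0, h0]))⟩
        have := hv'.1 0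
        rwa [show c 0 = (r, (c 0).2) from Prod.ext (h0 0) rfl] at this
    refine ⟨m.dst, r, e, hx ▸ hne, hx ▸ hr1, hr2, allows_iff.2 hp, he, hc, ?_⟩
    rw [ext_update_last, ext_last, ← hc]
  · intro hkm hk hl hp
    left
    simp only [ext_castSucc] at hp
    refine ⟨Function.update c k (m.dst, (c k).2.flip), by rw [ext_update, ext_castSucc], k,
      by simpa using hkm, ⟨by simpa using hk.1, fun l hls => ?_⟩, hne, fun l hlt => ?_, ?_, rfl⟩
    · simpa using hk.2 l.castSucc (by simpa using hls)
    · have : IsTop (ext c x) l.castSucc m.dst := by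
        refine ⟨by simpa using hlt.1, fun j => ?_⟩
        refine Fin.lastCases (fun _ => Fin.le_last _) (fun j hj => ?_) j
        simpa using hlt.2 j (by simpa using hj)
      simpa using hl _ this
    · intro q hq
      by_cases hd : m.dst = x.1
      · have hqx : q = x.2 := by simpa [pin, hd] using hq.symm
        -- The top disk on the post of the biggest disk shows the same colour as the biggest disk,
        -- and the magnetic rule forces the arriving disk to match it.
        obtain ⟨j, hj, -⟩ := exists_isTop (ext c x) (Fin.last n)
        rw [ext_last, ← hd] at hj
        have h1 := (hl j hj).2
        have h2 := hv.2 j (Fin.last n) (by rw [hj.1, ext_last, hd])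
        rw [ext_last] at h2
        rw [hqx, ← h2]
        simpa using Colour.eq_flip_of_ne h1
      · exact hp q (by rw [pin, Function.update_of_ne hd] at hq; exact hq)

/-- A run either never moves the biggest disk, or it gathers the smaller disks on a third post
before the first move of the biggest disk. -/
theorem Run.restrict {pre : PreColouring} {n : ℕ} {c' : State n} {x y : Post × Colour} :
    ∀ {L : List Move} {c : State n}, Valid pre (ext c x) → Run pre (ext c x) L (ext c' y) →
      (x = y ∧ Run (pin pre x) c L c') ∨
      ∃ L₁ L₂ p' r e, x.1 ≠ p' ∧ x.1 ≠ r ∧ p' ≠ r ∧ Allows pre (p', x.2.flip) ∧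
        Allows (pin pre x) (r, e) ∧ Run (pin pre x) c L₁ (tower n (r, e)) ∧
        Run pre (ext (tower n (r, e)) (p', x.2.flip)) L₂ (ext c' y) ∧
        L.length = L₁.length + 1 + L₂.length
  | [], c, _, h => Or.inl ⟨(ext_inj h).2, (ext_inj h).1⟩
  | m :: L, c, hv, ⟨c₁, hs, h⟩ => by
    rcases hs.restrict hv with ⟨c₂, rfl, hs'⟩ | ⟨p', r, e, h1, h2, h3, h4, h5, rfl, rfl⟩
    · rcases Run.restrict (hv.step hs) h with ⟨rfl, hr⟩ |
        ⟨L₁, L₂, p', r, e, h1, h2, h3, h4, h5, h6, h7, h8⟩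
      · exact Or.inl ⟨rfl, c₂, hs', hr⟩
      · exact Or.inr ⟨m :: L₁, L₂, p', r, e, h1, h2, h3, h4, h5, ⟨c₂, hs', h6⟩, h7, by
          simp only [List.length_cons, h8]; omega⟩
    · exact Or.inr ⟨[], L, p', r, e, h1, h2, h3, h4, h5, rfl, h, by simp; omega⟩

-- Lower bounds from potentials.

/-- A potential on the arrangements "biggest disk, tower of the smaller disks" that no move of the
biggest disk can lower by more than the moves it takes is a lower bound for the length of runs. -/
theorem potential_le_length {pre : PreColouring} {n : ℕ} {y : Post × Colour}
    (φ : Post × Colour → Post × Colour → ℕ)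
    (hfin : ∀ s L, Allows (pin pre y) s → Run (pin pre y) (tower n s) L (tower n y) →
      φ y s ≤ L.length)
    (hstep : ∀ b s p' r e L, Allows pre b → Allows (pin pre b) s → b.1 ≠ p' → b.1 ≠ r → p' ≠ r →
      Allows pre (p', b.2.flip) → Allows (pin pre b) (r, e) →
      Run (pin pre b) (tower n s) L (tower n (r, e)) →
      φ b s ≤ L.length + 1 + φ (p', b.2.flip) (r, e)) :
    ∀ N L b s, L.length ≤ N → Allows pre b → Allows (pin pre b) s →
      Run pre (ext (tower n s) b) L (tower (n + 1) y) → φ b s ≤ L.length := by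
  -- Induction on a bound for the length, because `Run.restrict` leaves a shorter run of unspecified
  -- length.
  intro N
  induction N with
  | zero =>
    intro L b s hN hb hs h
    rw [tower_succ] at h
    rcases h.restrict (valid_ext_tower hb hs) with ⟨rfl, hr⟩ |
      ⟨_, _, _, _, _, _, _, _, _, _, _, _, h8⟩
    · exact hfin s L hs hr
    · omega
  | succ N ih =>
    intro L b s hN hb hs h
    rw [tower_succ] at h
    rcases h.restrict (valid_ext_tower hb hs) with ⟨rfl, hr⟩ |
      ⟨L₁, L₂, p', r, e, h1, h2, h3, h4, h5, h6, h7, h8⟩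
    · exact hfin s L hs hr
    · rw [← tower_succ] at h7
      have hre : Allows (pin pre (p', b.2.flip)) (r, e) :=
        (allows_pin_of_ne (Ne.symm h3)).2 ((allows_pin_of_ne (Ne.symm h2)).1 h5)
      have := ih L₂ _ _ (by omega) h4 hre h7
      have := hstep b s p' r e L₁ hb hs h1 h2 h3 h4 h5 h6
      omega

/-- With the `if`, `simp` settles nested pins from the inequalities between posts. -/
theorem allows_pin {pre : PreColouring} {x y : Post × Colour} :
    Allows (pin pre x) y ↔ if y.1 = x.1 then y.2 = x.2 else Allows pre y := by
  split_ifs with h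
  · simp [Allows, pin, h, eq_comm]
  · exact allows_pin_of_ne h

theorem Step.run {pre : PreColouring} {n : ℕ} {c c' : State n} {m : Move} (h : Step pre c m c') :
    Run pre c [m] c' := ⟨c', h, rfl⟩

-- Legality of the algorithms.

/-- The list of moves `L` carries the tower of `n` disks from `s`, colour `a` up, to `d`. -/
def Carries (pre : PreColouring) (n : ℕ) (L : List Move) (s d : Post) (a : Colour) : Prop :=
  Run pre (tower n (s, a)) L (tower n (d, a.flip))

theorem Carries.lift {pre : PreColouring} {n : ℕ} {L : List Move} {s d : Post} {a : Colour}
    {x : Post × Colour} (h : Carries (pin pre x) n L s d a) (hx : Allows pre x) :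
    Run pre (ext (tower n (s, a)) x) L (ext (tower n (d, a.flip)) x) :=
  Run.lift hx h

/-- The two algorithms call each other, hence one induction. A post need only accept the colours
that the moves use, so the lemma serves coloured and neutral posts alike and survives pinning. -/
theorem carries_1000 (n : ℕ) : ∀ (pre : PreColouring) (s d i : Post) (a : Colour),
    s ≠ d → s ≠ i → d ≠ i → Allows pre (s, a) → Allows pre (d, a.flip) →
    (Allows pre (i, a.flip) → Carries pre n (SRBB1000 n s d i) s d a) ∧
    (Allows pre (i, a) → Carries pre n (SRRB1000 n s d i) s d a) := by
  induction n with
  | zero =>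
    intros
    simp only [SRBB1000, SRRB1000]
    exact ⟨fun _ => funext fun k => k.elim0, fun _ => funext fun k => k.elim0⟩
  | succ n ih =>
    intro pre s d i a hsd hsi hdi hs hd
    constructor
    · intro hi
      have h1 := ((ih (pin pre (s, a)) s i d a hsi hsd hdi.symm (by simp [allows_pin])
        (by simp [allows_pin, *, hsi.symm])).1 (by simp [allows_pin, *, hsd.symm])).lift hs
      have h2 := step_biggest (n := n) (e := a.flip) hsd hsi.symm hdi.symm hd
      have h3 := ((ih (pin pre (d, a.flip)) i s d a.flip hsi.symm hdi.symm hsd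
        (by simp [allows_pin, *, hdi.symm]) (by simp [allows_pin, *])).2
          (by simp [allows_pin])).lift hd
      have h4 := ((ih (pin pre (d, a.flip)) s d i a hsd hsi hdi
        (by simp [allows_pin, *]) (by simp [allows_pin])).1
          (by simp [allows_pin, *, hdi.symm])).lift hd
      rw [Colour.flip_flip] at h3
      simp only [Carries, tower_succ, SRBB1000]
      exact ((h1.append h2.run).append h3).append h4
    · intro hi
      have h1 := ((ih (pin pre (s, a)) s d i a hsd hsi hdi (by simp [allows_pin])
        (by simp [allows_pin, *, hsd.symm])).2 (by simp [allows_pin, *, hsi.symm])).lift hs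
      have h2 := ((ih (pin pre (s, a)) d i s a.flip hdi hsd.symm hsi.symm
        (by simp [allows_pin, *, hsd.symm]) (by simp [allows_pin, *, hsi.symm])).1
          (by simp [allows_pin])).lift hs
      have h3 := step_biggest (n := n) (e := a) hsd hsi.symm hdi.symm hd
      have h4 := ((ih (pin pre (d, a.flip)) i d s a hdi.symm hsi.symm hsd.symm
        (by simp [allows_pin, *, hdi.symm]) (by simp [allows_pin])).2
          (by simp [allows_pin, *])).lift hd
      rw [Colour.flip_flip] at h2
      simp only [Carries, tower_succ, SRRB1000]
      exact ((h1.append h2).append h3.run).append h4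

/-- The second half of `SRNB727` and of `SRNN636`: it starts with the biggest disk on the
destination and the other disks on the intermediate post. -/
theorem run_tail_727 {n : ℕ} {pre : PreColouring} {s d i : Post} {a : Colour} (hsd : s ≠ d)
    (hsi : s ≠ i) (hdi : d ≠ i) (hs : Allows pre (s, a)) (hd : Allows pre (d, a.flip))
    (hi' : Allows pre (i, a.flip))
    (h₁ : Carries (pin (pin pre (d, a.flip)) (s, a)) n (SRBN909 n d i s) d i a.flip)
    (h₂ : Carries (pin (pin pre (d, a.flip)) (d, a.flip)) n (SNRB909 n i d s) i d a) :
    Run pre (ext (tower (n + 1) (i, a.flip)) (d, a.flip))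
      (SRRB1000 n i s d ++ SRBB1000 n s d i ++ [⟨n, i, s⟩] ++
        SRBN909 n d i s ++ [⟨n, s, d⟩] ++ SNRB909 n i d s) (tower (n + 2) (d, a.flip)) := by
  rw [tower_succ (n + 1)]
  -- The biggest disk now stays on `d`. The second biggest must show `a.flip` at both ends, so it
  -- needs an even number of moves and goes through `s`.
  refine Run.lift hd ?_
  have q1 : Allows (pin pre (d, a.flip)) (i, a.flip) := by simp [allows_pin, *, hdi.symm]
  have q2 : Allows (pin pre (d, a.flip)) (s, a) := by simp [allows_pin, *]
  have q3 : Allows (pin pre (d, a.flip)) (d, a.flip) := allows_pin_self _ _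
  have k1 := ((carries_1000 n (pin (pin pre (d, a.flip)) (i, a.flip)) i s d a.flip hsi.symm
    hdi.symm hsd (by simp [allows_pin]) (by simp [allows_pin, *])).2
      (by simp [allows_pin, *])).lift q1
  have k2 := ((carries_1000 n (pin (pin pre (d, a.flip)) (i, a.flip)) s d i a hsd hsi hdi
    (by simp [allows_pin, *]) (by simp [allows_pin, *])).1 (by simp [allows_pin])).lift q1
  have k3 := step_biggest (n := n) (pre := pin pre (d, a.flip)) (e := a.flip) (a := a.flip)
    hsi.symm hdi hsd.symm (by simpa using q2)
  have k4 := h₁.lift q2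
  have k5 := step_biggest (n := n) (pre := pin pre (d, a.flip)) (e := a) (a := a)
    hsd hsi.symm hdi.symm q3
  have k6 := h₂.lift q3
  simp only [Colour.flip_flip] at k1 k3 k4
  simp only [tower_succ]
  exact ((((k1.append k2).append k3.run).append k4).append k5.run).append k6

/-- The first half of `SBNR727` and of `SNNB636`: it ends with the biggest disk on the
source and the other disks on the intermediate post. -/
theorem run_head_727 {n : ℕ} {pre : PreColouring} {s d i : Post} {a : Colour} (hsd : s ≠ d)
    (hsi : s ≠ i) (hdi : d ≠ i) (hs : Allows pre (s, a)) (hd : Allows pre (d, a.flip))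
    (hi : Allows pre (i, a))
    (h₁ : Carries (pin (pin pre (s, a)) (s, a)) n (SRBN909 n s i d) s i a)
    (h₂ : Carries (pin (pin pre (s, a)) (d, a.flip)) n (SNRB909 n i s d) i s a.flip) :
    Run pre (tower (n + 2) (s, a))
      (SRBN909 n s i d ++ [⟨n, s, d⟩] ++ SNRB909 n i s d ++ [⟨n, d, i⟩] ++
        SRRB1000 n s d i ++ SRBB1000 n d i s) (ext (tower (n + 1) (i, a)) (s, a)) := by
  rw [tower_succ (n + 1)]
  refine Run.lift hs ?_
  have q1 : Allows (pin pre (s, a)) (s, a) := allows_pin_self _ _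
  have q2 : Allows (pin pre (s, a)) (d, a.flip) := by simp [allows_pin, *, hsd.symm]
  have q3 : Allows (pin pre (s, a)) (i, a) := by simp [allows_pin, *]
  have k1 := h₁.lift q1
  have k2 := step_biggest (n := n) (pre := pin pre (s, a)) (e := a.flip) (a := a)
    hsd hsi.symm hdi.symm q2
  have k3 := h₂.lift q2
  have k4 := step_biggest (n := n) (pre := pin pre (s, a)) (e := a) (a := a.flip)
    hdi hsd hsi (by simpa using q3)
  have k5 := ((carries_1000 n (pin (pin pre (s, a)) (i, a)) s d i a hsd hsi hdi
    (by simp [allows_pin, *]) (by simp [allows_pin, *])).2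
      (by simp [allows_pin])).lift q3
  have k6 := ((carries_1000 n (pin (pin pre (s, a)) (i, a)) d i s a.flip hdi hsd.symm hsi.symm
    (by simp [allows_pin, *]) (by simp [allows_pin])).1
      (by simp [allows_pin, *])).lift q3
  simp only [Colour.flip_flip] at k3 k4 k6
  simp only [tower_succ]
  exact ((((k1.append k2.run).append k3).append k4.run).append k5).append k6

theorem carries_singleton {pre : PreColouring} {s d i : Post} {a : Colour}
    (hsd : s ≠ d) (hsi : s ≠ i) (hdi : d ≠ i) (hd : Allows pre (d, a.flip)) :
    Carries pre 1 [⟨0, s, d⟩] s d a := by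
  have h := (step_biggest (n := 0) (e := a) hsd hsi.symm hdi.symm hd).run
  -- Towers without disks are equal wherever they are said to stand.
  rw [show tower 0 (i, a) = tower 0 (s, a) from funext fun k => k.elim0] at h
  rw [Carries, tower_succ, tower_succ]
  rwa [show tower 0 (s, a) = tower 0 (d, a.flip) from funext fun k => k.elim0] at h ⊢

/-- The 727 algorithms call 909 one and two levels down, hence strong induction. The post required
to take both colours is the neutral one: `d` for `SRBN909`, `s` for `SNRB909`, `i` for the 727 pair.
-/
theorem carries_909_727 (n : ℕ) : ∀ (pre : PreColouring) (s d i : Post) (a : Colour),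
    s ≠ d → s ≠ i → d ≠ i → Allows pre (s, a) → Allows pre (d, a.flip) →
    (Allows pre (d, a) → Allows pre (i, a.flip) → Carries pre n (SRBN909 n s d i) s d a) ∧
    (Allows pre (s, a.flip) → Allows pre (i, a) → Carries pre n (SNRB909 n s d i) s d a) ∧
    (Allows pre (i, a) → Allows pre (i, a.flip) →
      Carries pre n (SRNB727 n s d i) s d a ∧ Carries pre n (SBNR727 n s d i) s d a) := by
  induction n using Nat.strong_induction_on with
  | _ n ih =>
  intro pre s d i a hsd hsi hdi hs hd
  refine ⟨fun hda hi => ?_, fun hsa hi => ?_, fun hi hia => ?_⟩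
  · rcases n with _ | n
    · rw [SRBN909]; exact funext fun k => k.elim0
    have h1 := ((ih n n.lt_succ_self (pin pre (s, a)) s i d a hsi hsd hdi.symm
      (by simp [allows_pin]) (by simp [allows_pin, *, hsi.symm])).2.2
      (by simp [allows_pin, *, hsd.symm]) (by simp [allows_pin, *, hsd.symm])).1.lift hs
    have h2 := step_biggest (n := n) (e := a.flip) hsd hsi.symm hdi.symm hd
    have h3 := ((carries_1000 n (pin pre (d, a.flip)) i s d a.flip hsi.symm hdi.symm hsd
      (by simp [allows_pin, *, hdi.symm]) (by simp [allows_pin, *])).2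
        (by simp [allows_pin])).lift hd
    have h4 := ((carries_1000 n (pin pre (d, a.flip)) s d i a hsd hsi hdi
      (by simp [allows_pin, *]) (by simp [allows_pin])).1
        (by simp [allows_pin, *, hdi.symm])).lift hd
    rw [Colour.flip_flip] at h3
    simp only [Carries, tower_succ, SRBN909]
    exact ((h1.append h2.run).append h3).append h4
  · rcases n with _ | n
    · rw [SNRB909]; exact funext fun k => k.elim0
    have h1 := ((carries_1000 n (pin pre (s, a)) s d i a hsd hsi hdi (by simp [allows_pin])
      (by simp [allows_pin, *, hsd.symm])).2 (by simp [allows_pin, *, hsi.symm])).lift hs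
    have h2 := ((carries_1000 n (pin pre (s, a)) d i s a.flip hdi hsd.symm hsi.symm
      (by simp [allows_pin, *, hsd.symm]) (by simp [allows_pin, *, hsi.symm])).1
        (by simp [allows_pin])).lift hs
    have h3 := step_biggest (n := n) (e := a) hsd hsi.symm hdi.symm hd
    have h4 := ((ih n n.lt_succ_self (pin pre (d, a.flip)) i d s a hdi.symm hsi.symm hsd.symm
      (by simp [allows_pin, *, hdi.symm]) (by simp [allows_pin])).2.2
        (by simp [allows_pin, *]) (by simp [allows_pin, *])).2.lift hd
    rw [Colour.flip_flip] at h2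
    simp only [Carries, tower_succ, SNRB909]
    exact ((h1.append h2).append h3.run).append h4
  · rcases n with _ | _ | n
    · rw [SRNB727, SBNR727]; exact ⟨funext fun k => k.elim0, funext fun k => k.elim0⟩
    · rw [SRNB727, SBNR727]
      exact ⟨carries_singleton hsd hsi hdi hd, carries_singleton hsd hsi hdi hd⟩
    constructor
    · have h1 := ((ih (n + 1) (by omega) (pin pre (s, a)) s i d a hsi hsd hdi.symm
        (by simp [allows_pin]) (by simp [allows_pin, *, hsi.symm])).1
        (by simp [allows_pin, *, hsi.symm]) (by simp [allows_pin, *, hsd.symm])).lift hs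
      have h2 := step_biggest (n := n + 1) (e := a.flip) hsd hsi.symm hdi.symm hd
      have h3 := run_tail_727 hsd hsi hdi hs hd hia
        ((ih n (by omega) _ d i s a.flip hdi hsd.symm hsi.symm
          (by simp [allows_pin, hsd.symm]) (by simp [allows_pin, *, hdi.symm, hsi.symm])).1
          (by simp [allows_pin, *, hdi.symm, hsi.symm]) (by simp [allows_pin]))
        ((ih n (by omega) _ i d s a hdi.symm hsi.symm hsd.symm
          (by simp [allows_pin, *, hdi.symm]) (by simp [allows_pin])).2.1
          (by simp [allows_pin, *, hdi.symm]) (by simp [allows_pin, *]))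
      have := (h1.append h2.run).append h3
      simpa only [Carries, SRNB727, List.append_assoc, ← tower_succ] using this
    · have h1 := run_head_727 hsd hsi hdi hs hd hi
        ((ih n (by omega) _ s i d a hsi hsd hdi.symm
          (by simp [allows_pin]) (by simp [allows_pin, *, hsi.symm])).1
          (by simp [allows_pin, *, hsi.symm]) (by simp [allows_pin, *, hsd.symm]))
        ((ih n (by omega) _ i s d a.flip hsi.symm hdi.symm hsd
          (by simp [allows_pin, *, hsi.symm, hdi.symm]) (by simp [allows_pin, *])).2.1
          (by simp [allows_pin, *, hdi.symm, hsi.symm]) (by simp [allows_pin]))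
      have h2 := step_biggest (n := n + 1) (e := a) hsd hsi.symm hdi.symm hd
      have h3 := ((ih (n + 1) (by omega) (pin pre (d, a.flip)) i d s a hdi.symm hsi.symm hsd.symm
        (by simp [allows_pin, *, hdi.symm]) (by simp [allows_pin])).2.1
        (by simp [allows_pin, *, hdi.symm]) (by simp [allows_pin, *])).lift hd
      have := (h1.append h2.run).append h3
      simpa only [Carries, SBNR727, List.append_assoc, ← tower_succ] using this

/-- Only the first call differs from `SRNB727`: under a biggest disk on a red source, the two other
posts are still neutral. -/
theorem carries_SRNN636 (n : ℕ) : ∀ (pre : PreColouring) (s d i : Post) (a : Colour),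
    s ≠ d → s ≠ i → d ≠ i → Allows pre (s, a) → Allows pre (d, a) → Allows pre (d, a.flip) →
    Allows pre (i, a) → Allows pre (i, a.flip) → Carries pre n (SRNN636 n s d i) s d a := by
  induction n with
  | zero => intros; rw [SRNN636]; exact funext fun k => k.elim0
  | succ n ih =>
    intro pre s d i a hsd hsi hdi hs hd hd' hi hi'
    rcases n with _ | n
    · rw [SRNN636]; exact carries_singleton hsd hsi hdi hd'
    have h1 := (ih (pin pre (s, a)) s i d a hsi hsd hdi.symm (by simp [allows_pin])
      (by simp [allows_pin, *, hsi.symm]) (by simp [allows_pin, *, hsi.symm])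
      (by simp [allows_pin, *, hsd.symm]) (by simp [allows_pin, *, hsd.symm])).lift hs
    have h2 := step_biggest (n := n + 1) (e := a.flip) hsd hsi.symm hdi.symm hd'
    have h3 := run_tail_727 (n := n) hsd hsi hdi hs hd' hi'
      ((carries_909_727 n _ d i s a.flip hdi hsd.symm hsi.symm
        (by simp [allows_pin, hsd.symm]) (by simp [allows_pin, *, hdi.symm, hsi.symm])).1
        (by simp [allows_pin, *, hdi.symm, hsi.symm]) (by simp [allows_pin]))
      ((carries_909_727 n _ i d s a hdi.symm hsi.symm hsd.symm
        (by simp [allows_pin, *, hdi.symm]) (by simp [allows_pin])).2.1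
        (by simp [allows_pin, *, hdi.symm]) (by simp [allows_pin, *]))
    have := (h1.append h2.run).append h3
    simpa only [Carries, SRNN636, List.append_assoc, ← tower_succ] using this

theorem carries_SNNB636 (n : ℕ) : ∀ (pre : PreColouring) (s d i : Post) (a : Colour),
    s ≠ d → s ≠ i → d ≠ i → Allows pre (s, a) → Allows pre (s, a.flip) → Allows pre (d, a.flip) →
    Allows pre (i, a) → Allows pre (i, a.flip) → Carries pre n (SNNB636 n s d i) s d a := by
  induction n with
  | zero => intros; rw [SNNB636]; exact funext fun k => k.elim0
  | succ n ih =>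
    intro pre s d i a hsd hsi hdi hs hs' hd hi hi'
    rcases n with _ | n
    · rw [SNNB636]; exact carries_singleton hsd hsi hdi hd
    have h1 := run_head_727 (n := n) hsd hsi hdi hs hd hi
      ((carries_909_727 n _ s i d a hsi hsd hdi.symm
        (by simp [allows_pin]) (by simp [allows_pin, *, hsi.symm])).1
        (by simp [allows_pin, *, hsi.symm]) (by simp [allows_pin, *, hsd.symm]))
      ((carries_909_727 n _ i s d a.flip hsi.symm hdi.symm hsd
        (by simp [allows_pin, *, hsi.symm, hdi.symm]) (by simp [allows_pin, *])).2.1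
        (by simp [allows_pin, *, hdi.symm, hsi.symm]) (by simp [allows_pin]))
    have h2 := step_biggest (n := n + 1) (e := a) hsd hsi.symm hdi.symm hd
    have h3 := (ih (pin pre (d, a.flip)) i d s a hdi.symm hsi.symm hsd.symm
      (by simp [allows_pin, *, hdi.symm]) (by simp [allows_pin, *, hdi.symm])
      (by simp [allows_pin]) (by simp [allows_pin, *]) (by simp [allows_pin, *])).lift hd
    have := (h1.append h2.run).append h3
    simpa only [Carries, SNNB636, List.append_assoc, ← tower_succ] using this

/-! The lengths of shortest runs between towers. In a pre-colouring with three coloured posts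
(two of them alike), the moves always use the odd post; `dAdj` is the distance between it and
another post, and twice that is the distance between the two others. -/

mutual

def dAdj : ℕ → ℕ
  | 0 => 0
  | n + 1 => 3 * dAdj n + 1

/-- One post red, one blue, one neutral: between a coloured post and the neutral post, with
different colours up at the ends. -/
def dDiff : ℕ → ℕ
  | 0 => 0
  | n + 1 => dFixed n + 2 * dAdj n + 1

/-- One post red, one blue, one neutral: between the coloured posts. -/
def dFixed : ℕ → ℕ
  | 0 => 0
  | n + 1 => dDiff n + dSame n + 1

/-- One post red, one blue, one neutral: between a coloured post and the neutral post, with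
the same colour up at the ends. -/
def dSame : ℕ → ℕ
  | 0 => 0
  | n + 1 => 2 * dAdj n + 2 * dDiff n + 2

end

/-- One post red, one blue, one neutral: turning over the tower on the neutral post. -/
def dTurn : ℕ → ℕ
  | 0 => 0
  | n + 1 => 4 * dAdj n + dDiff n + dSame n + 3

/-- Two neutral posts: from the coloured post to another one, with different colours up. -/
def eDiff : ℕ → ℕ
  | 0 => 0
  | n + 1 => eDiff n + dSame n + 1

/-- Two neutral posts: from the coloured post to another one, with the same colour up. -/
def eSame : ℕ → ℕ
  | 0 => 0
  | n + 1 => eDiff n + dDiff n + 2 * dAdj n + 2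

/-- Two neutral posts: turning over the tower on a neutral post. -/
def eTurn : ℕ → ℕ
  | 0 => 0
  | n + 1 => 2 * dAdj n + 3 * dDiff n + 3

/-- Two neutral posts: between them, at both ends with the colour up which the coloured post
does not have. -/
def eOther : ℕ → ℕ
  | 0 => 0
  | n + 1 => dSame n + 2 * dDiff n + 2

/-- Two neutral posts: between them, at both ends with the colour of the coloured post up. -/
def eOwn : ℕ → ℕ
  | 0 => 0
  | n + 1 => 4 * dAdj n + 2 * dDiff n + eOther n + 4

/-- These are the comparisons, mostly of triangle type, that remain when the potentials are checked.
They are proved together since each one at n + 1 may need others at n. -/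
theorem d_inequalities (n : ℕ) :
    dFixed n ≤ dDiff n ∧ dDiff n ≤ dSame n ∧ dDiff n ≤ dAdj n ∧ dSame n ≤ 2 * dDiff n ∧
    dSame n ≤ dFixed n + dDiff n + 2 ∧ dSame n ≤ dTurn n ∧ dAdj n ≤ dFixed n + dDiff n + dSame n ∧
    2 * dAdj n ≤ 2 * dDiff n + dSame n + 2 ∧ dDiff n + dSame n ≤ dFixed n + 2 * dAdj n := by
  induction n with
  | zero => simp [dFixed, dDiff, dAdj, dSame, dTurn]
  | succ n ih =>
    simp only [dFixed, dDiff, dAdj, dSame, dTurn]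
    omega

theorem e_inequalities (n : ℕ) :
    eDiff n + dSame n ≤ eSame n + dDiff n ∧ dSame n ≤ eTurn n ∧ dSame n ≤ eOwn n ∧
    eOther n ≤ dSame n ∧ 2 * dDiff n ≤ dSame n + eOther n := by
  induction n with
  | zero => simp [dDiff, dSame, eDiff, eSame, eTurn, eOwn, eOther]
  | succ n ih =>
    have := d_inequalities n
    simp only [dDiff, dSame, eDiff, eSame, eTurn, eOwn, eOther]
    omega

/-- The distance between towers, three posts being coloured, `m` the odd one. -/
def distCol (n : ℕ) (m : Post) (x y : Post × Colour) : ℕ :=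
  if x = y then 0 else if x.1 = m ∨ y.1 = m then dAdj n else 2 * dAdj n

/-- The distance between towers, `d` being neutral and the other posts of different colours. -/
def distNeutral (n : ℕ) (d : Post) (x y : Post × Colour) : ℕ :=
  if x = y then 0 else if x.1 = y.1 then dTurn n else if x.1 ≠ d ∧ y.1 ≠ d then dFixed n
  else if x.2 = y.2 then dSame n else dDiff n

/-- The distance between towers, only `s` being coloured, with colour `a`. -/
def distNeutral₂ (n : ℕ) (s : Post) (a : Colour) (x y : Post × Colour) : ℕ :=
  if x = y then 0 else if x.1 = y.1 then eTurn n else if x.1 = s ∨ y.1 = s then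
    if x.2 = y.2 then eSame n else eDiff n
  else if x.2 ≠ y.2 then dDiff n else if x.2 = a then eOwn n else eOther n

-- Reduction to a standard colouring, and the tables of potentials.

/-- The renaming of posts which takes `s` to the Source, `i` to the Intermediate post. -/
def toStandard (s i p : Post) : Post := if p = s then .S else if p = i then .I else .D

/-- The renaming of colours which takes `a` to red. -/
def toRed (a c : Colour) : Colour := if c = a then .red else .blue

/-- Thanks to this renaming, each potential has to be checked in one concrete pre-colouring only. -/
theorem Run.standardize {pre : PreColouring} {n : ℕ} {s i d : Post} (a : Colour) (hsi : s ≠ i)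
    (hsd : s ≠ d) (hid : i ≠ d) {x y : Post × Colour} {L : List Move}
    (h : Run pre (tower n x) L (tower n y)) :
    ∃ L', L'.length = L.length ∧
      Run (preColouring ((pre s).map (toRed a)) ((pre i).map (toRed a)) ((pre d).map (toRed a)))
        (tower n (toStandard s i x.1, toRed a x.2)) L'
        (tower n (toStandard s i y.1, toRed a y.2)) := by
  have hall : ∀ p, p = s ∨ p = i ∨ p = d := by
    revert hsi hsd hid
    cases s <;> cases i <;> cases d <;> intro _ _ _ p <;> cases p <;> simp_all
  refine h.relabel (f := toStandard s i) (g := toRed a) ?_ ?_ ?_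
  · intro p q hpq
    rcases hall p with rfl | rfl | rfl <;> rcases hall q with rfl | rfl | rfl <;>
      simp_all [toStandard, eq_comm]
  · intro c
    cases a <;> cases c <;> rfl
  · intro p
    rcases hall p with rfl | rfl | rfl
    · simp [toStandard, preColouring]
    · simp [toStandard, preColouring, hsi.symm]
    · simp [toStandard, preColouring, hsd.symm, hid.symm]

/-- Every run from the tower on `x` to the tower on `y` has at least `m` moves. -/
def Far (pre : PreColouring) (n : ℕ) (x y : Post × Colour) (m : ℕ) : Prop :=
  ∀ L, Run pre (tower n x) L (tower n y) → m ≤ L.length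

theorem Far.symm {pre : PreColouring} {n : ℕ} {x y : Post × Colour} {m : ℕ}
    (h : Far pre n x y m) (hy : Allows pre y) : Far pre n y x m := by
  intro L hL
  obtain ⟨L', hl, hr⟩ := hL.reverse (valid_tower hy)
  exact hl ▸ h L' hr

theorem Far.mono {pre : PreColouring} {n : ℕ} {x y : Post × Colour} {m m' : ℕ}
    (h : Far pre n x y m) (hm : m' ≤ m) : Far pre n x y m' :=
  fun L hL => hm.trans (h L hL)

theorem far_zero (pre : PreColouring) (n : ℕ) (x y : Post × Colour) : Far pre n x y 0 :=
  fun _ _ => Nat.zero_le _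

theorem Far.of_standard {pre : PreColouring} {n : ℕ} {s i d : Post} {a : Colour} {m : ℕ}
    {x y : Post × Colour} (hsi : s ≠ i) (hsd : s ≠ d) (hid : i ≠ d)
    (h : Far (preColouring ((pre s).map (toRed a)) ((pre i).map (toRed a))
      ((pre d).map (toRed a))) n (toStandard s i x.1, toRed a x.2)
        (toStandard s i y.1, toRed a y.2) m) : Far pre n x y m := by
  intro L hL
  obtain ⟨L', hl, hr⟩ := hL.standardize a hsi hsd hid
  exact hl ▸ h L' hr

/-- A version of `potential_le_length` for lower bounds `δ b` on the distances of the smaller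
disks while the biggest disk lies as `b` says. -/
theorem far_of_potential {pre : PreColouring} {n : ℕ} {x y : Post × Colour}
    (δ : Post × Colour → Post × Colour → Post × Colour → ℕ)
    (φ : Post × Colour → Post × Colour → ℕ) (hx : Allows pre x)
    (hδ : ∀ b s r, Allows pre b → Allows (pin pre b) s → Allows (pin pre b) r →
      Far (pin pre b) n s r (δ b s r))
    (hfin : ∀ s, Allows (pin pre y) s → φ y s ≤ δ y s y)
    (hstep : ∀ b s p' r e, Allows pre b → Allows (pin pre b) s → b.1 ≠ p' → b.1 ≠ r → p' ≠ r →
      Allows pre (p', b.2.flip) → Allows (pin pre b) (r, e) →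
      φ b s ≤ δ b s (r, e) + 1 + φ (p', b.2.flip) (r, e)) (hy : Allows pre y) :
    Far pre (n + 1) x y (φ x x) := by
  intro L hL
  rw [tower_succ n x] at hL
  refine potential_le_length φ (fun s L hs h => ?_)
    (fun b s p' r e L h1 h2 h3 h4 h5 h6 h7 h => ?_) L.length L x x le_rfl hx
    (allows_pin_self _ _) hL
  · exact (hfin s hs).trans (hδ y s y hy hs (allows_pin_self _ _) L h)
  · have := hδ b s (r, e) h1 h2 h7 L h
    have := hstep b s p' r e h1 h2 h3 h4 h5 h6 h7
    omega

/-- In the pre-colouring RBB: the number of moves to the tower on the Destination, blue up, from the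
arrangement with the biggest disk as told by the first argument and the `n` smaller disks stacked
as told by the second. -/
def potRBBDB (n : ℕ) : Post × Colour → Post × Colour → ℕ
  | (.D, .blue), (.S, .red) => dAdj n
  | (.D, .blue), (.I, .blue) => 2 * dAdj n
  | (.D, .blue), (.D, .blue) => 0
  | (.S, .red), (.S, .red) => 3 * dAdj n + 1
  | (.S, .red), (.I, .blue) => 2 * dAdj n + 1
  | (.S, .red), (.D, .blue) => 4 * dAdj n + 1
  | (.I, .blue), (.S, .red) => 5 * dAdj n + 2
  | (.I, .blue), (.I, .blue) => 6 * dAdj n + 2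
  | (.I, .blue), (.D, .blue) => 4 * dAdj n + 2
  -- Only arrangements forbidden by the pre-colouring are left.
  | _, _ => 0

/-- In the pre-colouring RBN: the number of moves to the tower on the Destination, blue up, from the
arrangement with the biggest disk as told by the first argument and the `n` smaller disks stacked
as told by the second. -/
def potRBNDB (n : ℕ) : Post × Colour → Post × Colour → ℕ
  | (.D, .blue), (.S, .red) => dAdj n
  | (.D, .blue), (.I, .blue) => 2 * dAdj n
  | (.D, .blue), (.D, .blue) => 0
  | (.S, .red), (.S, .red) => 2 * dAdj n + dFixed n + 1
  | (.S, .red), (.I, .blue) => 2 * dAdj n + 1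
  | (.S, .red), (.D, .red) => 2 * dAdj n + dDiff n + 1
  | (.S, .red), (.D, .blue) => 2 * dAdj n + dSame n + 1
  | (.I, .blue), (.S, .red) => 2 * dAdj n + dDiff n + dSame n + 2
  | (.I, .blue), (.I, .blue) => 2 * dAdj n + 2 * dDiff n + 2
  | (.I, .blue), (.D, .red) => 2 * dAdj n + dDiff n + 2
  | (.I, .blue), (.D, .blue) => 2 * dAdj n + dSame n + 2
  | (.D, .red), (.S, .red) => 2 * dAdj n + dDiff n + dSame n + 3
  | (.D, .red), (.I, .blue) => 3 * dAdj n + dDiff n + dSame n + 3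
  | (.D, .red), (.D, .red) => 4 * dAdj n + dDiff n + dSame n + 3
  | _, _ => 0

/-- In the pre-colouring RBN: the number of moves to the tower on the Intermediate post, blue up, from the
arrangement with the biggest disk as told by the first argument and the `n` smaller disks stacked
as told by the second. -/
def potRBNIB (n : ℕ) : Post × Colour → Post × Colour → ℕ
  | (.I, .blue), (.S, .red) => dFixed n
  | (.I, .blue), (.I, .blue) => 0
  | (.I, .blue), (.D, .red) => dDiff n
  | (.I, .blue), (.D, .blue) => dSame n
  | (.S, .red), (.S, .red) => dDiff n + dSame n + 1
  | (.S, .red), (.I, .blue) => 2 * dDiff n + 1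
  | (.S, .red), (.D, .red) => dDiff n + 1
  | (.S, .red), (.D, .blue) => dSame n + 1
  | (.D, .red), (.S, .red) => dFixed n + 1
  | (.D, .red), (.I, .blue) => dAdj n + dFixed n + 1
  | (.D, .red), (.D, .red) => 2 * dAdj n + dFixed n + 1
  | (.D, .blue), (.S, .red) => dAdj n + 2 * dDiff n + 2
  | (.D, .blue), (.I, .blue) => 2 * dDiff n + 2
  | (.D, .blue), (.D, .blue) => 2 * dAdj n + 2 * dDiff n + 2
  | _, _ => 0

/-- Splits a goal into six concrete cases, so that `decide` can discard the forbidden ones. -/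
theorem forall_post_colour {P : Post × Colour → Prop} (h1 : P (.S, .red)) (h2 : P (.S, .blue))
    (h3 : P (.I, .red)) (h4 : P (.I, .blue)) (h5 : P (.D, .red)) (h6 : P (.D, .blue)) :
    ∀ x, P x := by
  rintro ⟨_ | _ | _, _ | _⟩ <;> assumption

-- Distances with three coloured posts.

/-- The lower bound for the distances of towers when all posts are coloured. -/
def FarCol (n : ℕ) : Prop := ∀ (pre : PreColouring) (s i d : Post) (a : Colour),
  s ≠ i → s ≠ d → i ≠ d → pre s = some a → pre i = some a.flip → pre d = some a.flip →
  ∀ x y, Allows pre x → Allows pre y → Far pre n x y (distCol n s x y)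

def RBB : PreColouring := preColouring (some .red) (some .blue) (some .blue)

theorem FarCol.far_potRBBDB {n : ℕ} (h : FarCol n) (x : Post × Colour) (hx : Allows RBB x) :
    Far RBB (n + 1) x (.D, .blue) (potRBBDB n x x) := by
  -- The biggest disk always shows the colour of its post, so pinning changes nothing and the
  -- distances do not depend on it.
  refine far_of_potential (fun _ s r => distCol n .S s r) _ hx ?_ ?_ ?_ (by decide)
  · intro b s r hb
    refine h _ .S .I .D .red (by decide) (by decide) (by decide) ?_ ?_ ?_ s r <;>
      revert b <;> refine forall_post_colour ?_ ?_ ?_ ?_ ?_ ?_ <;> decide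
  · refine forall_post_colour ?_ ?_ ?_ ?_ ?_ ?_ <;> intro h <;>
    first
    | exact absurd h (by decide)
    | simp [potRBBDB, distCol]
  -- All conceivable moves of the biggest disk: forbidden ones fall to `decide`, each remaining one
  -- is a linear inequality.
  · refine forall_post_colour ?_ ?_ ?_ ?_ ?_ ?_ <;>
    refine forall_post_colour ?_ ?_ ?_ ?_ ?_ ?_ <;>
    intro p' r e h1 h2 h3 h4 h5 h6 h7 <;>
    first
    | exact absurd h1 (by decide)
    | exact absurd h2 (by decide)
    | (cases p' <;> first
        | exact absurd h3 (by decide)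
        | exact absurd h6 (by decide)
        | (cases r <;> first
            | exact absurd h4 (by decide)
            | exact absurd h5 (by decide)
            | (cases e <;> first
              | exact absurd h7 (by decide)
              | (simp [potRBBDB, distCol, Colour.flip]; try omega))))


theorem eq_of_allows_some {pre : PreColouring} {x : Post × Colour} {a : Colour}
    (h : Allows pre x) (hx : pre x.1 = some a) : x.2 = a :=
  allows_iff.1 h a hx

theorem eq_or_eq_or_eq {s i d : Post} (hsi : s ≠ i) (hsd : s ≠ d) (hid : i ≠ d) (p : Post) :
    p = s ∨ p = i ∨ p = d := by
  cases s <;> cases i <;> cases d <;> cases p <;> simp_all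

/-- The potential gives the two distances to one of the like-coloured posts; exchanging `i` with `d`
and reversing time give the rest. -/
theorem FarCol.succ {n : ℕ} (h : FarCol n) : FarCol (n + 1) := by
  have key : ∀ (pre : PreColouring) (s i d : Post) (a : Colour),
      s ≠ i → s ≠ d → i ≠ d → pre s = some a → pre i = some a.flip → pre d = some a.flip →
      Far pre (n + 1) (s, a) (d, a.flip) (dAdj (n + 1)) ∧
      Far pre (n + 1) (i, a.flip) (d, a.flip) (2 * dAdj (n + 1)) := by
    intro pre s i d a hsi hsd hid hs hi hd
    have hr : toRed a a = .red := by simp [toRed]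
    have hb : toRed a a.flip = .blue := by simp [toRed, Colour.flip_ne]
    constructor <;> apply Far.of_standard (a := a) hsi hsd hid <;>
      simp only [hs, hi, hd, Option.map_some, hr, hb, toStandard, if_true, hsi.symm, hsd.symm,
        hid.symm, if_false]
    · exact h.far_potRBBDB (.S, .red) (by decide)
    · exact (h.far_potRBBDB (.I, .blue) (by decide)).mono (by simp only [potRBBDB, dAdj]; omega)
  intro pre s i d a hsi hsd hid hs hi hd
  have h1 := key pre s i d a hsi hsd hid hs hi hd
  have h2 := key pre s d i a hsd hsi hid.symm hs hd hi
  have as : Allows pre (s, a) := Or.inr hs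
  have ai : Allows pre (i, a.flip) := Or.inr hi
  have ad : Allows pre (d, a.flip) := Or.inr hd
  have hall : ∀ x, Allows pre x → x = (s, a) ∨ x = (i, a.flip) ∨ x = (d, a.flip) := by
    rintro ⟨p, c⟩ hx
    rcases eq_or_eq_or_eq hsi hsd hid p with rfl | rfl | rfl
    · simp [← eq_of_allows_some hx hs]
    · simp [← eq_of_allows_some hx hi]
    · simp [← eq_of_allows_some hx hd]
  intro x y hx hy
  rcases hall x hx with rfl | rfl | rfl <;> rcases hall y hy with rfl | rfl | rfl <;>
    simp only [distCol, Prod.mk.injEq, hsi, hsi.symm, hsd, hsd.symm, hid, hid.symm,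
      false_and, if_true, if_false, or_true, true_or, or_self] <;>
    first
    | exact far_zero _ _ _ _
    | exact h1.1
    | exact h1.2
    | exact h2.1
    | exact h2.2
    | exact h1.1.symm hx
    | exact h2.1.symm hx

theorem farCol (n : ℕ) : FarCol n := by
  induction n with
  | zero =>
    intro pre s i d a _ _ _ _ _ _ x y _ _
    have : distCol 0 s x y = 0 := by simp [distCol, dAdj]
    rw [this]
    exact far_zero _ _ _ _
  | succ n ih => exact ih.succ

-- Distances with one neutral post.

/-- A neutral post next to two posts of one colour is as good as a post of the other colour. -/
theorem Run.pin_of_neutral {pre : PreColouring} {n : ℕ} {c' : State n} {d : Post} {a : Colour}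
    (hp : ∀ p, p ≠ d → pre p = some a) :
    ∀ {L : List Move} {c : State n}, Valid (pin pre (d, a.flip)) c → Run pre c L c' →
      Run (pin pre (d, a.flip)) c L c'
  | [], _, _, h => h
  | m :: L, c, hv, ⟨c₁, hs, h⟩ => by
    have hs' : Step (pin pre (d, a.flip)) c m c₁ := by
      obtain ⟨k, hkm, hk, hne, hl, hq, rfl⟩ := hs
      refine ⟨k, hkm, hk, hne, hl, fun q hq' => ?_, rfl⟩
      by_cases hd : m.dst = d
      · have h1 : (c k).1 ≠ d := by rw [hk.1, ← hd]; exact hne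
        have h2 := (allows_pin_of_ne (pre := pre) (x := (d, a.flip)) h1).1 (hv.1 k)
        rw [eq_of_allows_some h2 (hp _ h1)]
        simpa [pin, hd] using hq'
      · exact hq q (by rwa [pin, Function.update_of_ne hd] at hq')
    exact ⟨c₁, hs', Run.pin_of_neutral hp (hv.step hs') h⟩

/-- The lower bound for the distances of towers with one neutral post. -/
def FarNeutral (n : ℕ) : Prop := ∀ (pre : PreColouring) (s i d : Post) (a : Colour),
  s ≠ i → s ≠ d → i ≠ d → pre s = some a → pre i = some a.flip → pre d = none →
  ∀ x y, Allows pre x → Allows pre y → Far pre n x y (distNeutral n d x y)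

def RBN : PreColouring := preColouring (some .red) (some .blue) none

/-- Distances between towers of `n` disks in the pre-colouring RBN, a bigger disk lying as told
by the first argument. -/
def distRBN (n : ℕ) : Post × Colour → Post × Colour → Post × Colour → ℕ
  | (.D, .blue) => distCol n .S
  | (.D, .red) => distCol n .I
  | _ => distNeutral n .D

def FarBelowRBN (n : ℕ) : Prop := ∀ b s r, Allows RBN b → Allows (pin RBN b) s →
  Allows (pin RBN b) r → Far (pin RBN b) n s r (distRBN n b s r)

/-- A biggest disk on the neutral post colours it; then the odd post is I if that disk shows red, S
if blue. On S or I it changes nothing. -/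
theorem FarNeutral.farBelowRBN {n : ℕ} (h : FarNeutral n) : FarBelowRBN n := by
  intro b s r
  revert b
  refine forall_post_colour ?_ ?_ ?_ ?_ ?_ ?_ <;> intro hb
  · exact h _ .S .I .D .red (by decide) (by decide) (by decide) rfl rfl rfl s r
  · exact absurd hb (by decide)
  · exact absurd hb (by decide)
  · exact h _ .S .I .D .red (by decide) (by decide) (by decide) rfl rfl rfl s r
  · exact farCol n _ .I .S .D .blue (by decide) (by decide) (by decide) rfl rfl rfl s r
  · exact farCol n _ .S .I .D .red (by decide) (by decide) (by decide) rfl rfl rfl s r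

theorem far_potRBNDB {n : ℕ} (h : FarBelowRBN n) (x : Post × Colour)
    (hx : Allows RBN x) : Far RBN (n + 1) x (.D, .blue) (potRBNDB n x x) := by
  refine far_of_potential (distRBN n) _ hx h ?_ ?_ (by decide)
  · refine forall_post_colour ?_ ?_ ?_ ?_ ?_ ?_ <;> intro h <;>
    first
    | exact absurd h (by decide)
    | simp [potRBNDB, distRBN, distCol]
  · have hd := d_inequalities n
    refine forall_post_colour ?_ ?_ ?_ ?_ ?_ ?_ <;>
    refine forall_post_colour ?_ ?_ ?_ ?_ ?_ ?_ <;>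
    intro p' r e h1 h2 h3 h4 h5 h6 h7 <;>
    first
    | exact absurd h1 (by decide)
    | exact absurd h2 (by decide)
    | (cases p' <;> first
        | exact absurd h3 (by decide)
        | exact absurd h6 (by decide)
        | (cases r <;> first
            | exact absurd h4 (by decide)
            | exact absurd h5 (by decide)
            | (cases e <;> first
              | exact absurd h7 (by decide)
              | (simp [potRBNDB, distRBN, distCol, distNeutral, Colour.flip]; try omega))))

theorem far_potRBNIB {n : ℕ} (h : FarBelowRBN n) (x : Post × Colour)
    (hx : Allows RBN x) : Far RBN (n + 1) x (.I, .blue) (potRBNIB n x x) := by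
  refine far_of_potential (distRBN n) _ hx h ?_ ?_ (by decide)
  · refine forall_post_colour ?_ ?_ ?_ ?_ ?_ ?_ <;> intro h <;>
    first
    | exact absurd h (by decide)
    | simp [potRBNIB, distRBN, distNeutral]
  · have hd := d_inequalities n
    refine forall_post_colour ?_ ?_ ?_ ?_ ?_ ?_ <;>
    refine forall_post_colour ?_ ?_ ?_ ?_ ?_ ?_ <;>
    intro p' r e h1 h2 h3 h4 h5 h6 h7 <;>
    first
    | exact absurd h1 (by decide)
    | exact absurd h2 (by decide)
    | (cases p' <;> first
        | exact absurd h3 (by decide)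
        | exact absurd h6 (by decide)
        | (cases r <;> first
            | exact absurd h4 (by decide)
            | exact absurd h5 (by decide)
            | (cases e <;> first
              | exact absurd h7 (by decide)
              | (simp [potRBNIB, distRBN, distCol, distNeutral, Colour.flip]; try omega))))

/-- The coloured posts play symmetric roles once the colours are exchanged too: this is the second
use of `key`, with `a.flip`. Time reversal yields the remaining pairs. -/
theorem FarNeutral.succ {n : ℕ} (h : FarNeutral n) : FarNeutral (n + 1) := by
  have key : ∀ (pre : PreColouring) (s i d : Post) (a : Colour),
      s ≠ i → s ≠ d → i ≠ d → pre s = some a → pre i = some a.flip → pre d = none →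
      Far pre (n + 1) (s, a) (d, a.flip) (dDiff (n + 1)) ∧
      Far pre (n + 1) (i, a.flip) (d, a.flip) (dSame (n + 1)) ∧
      Far pre (n + 1) (d, a) (d, a.flip) (dTurn (n + 1)) ∧
      Far pre (n + 1) (s, a) (i, a.flip) (dFixed (n + 1)) := by
    intro pre s i d a hsi hsd hid hs hi hd
    have hr : toRed a a = .red := by simp [toRed]
    have hb : toRed a a.flip = .blue := by simp [toRed, Colour.flip_ne]
    have hB := h.farBelowRBN
    refine ⟨?_, ?_, ?_, ?_⟩ <;> apply Far.of_standard (a := a) hsi hsd hid <;>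
      simp only [hs, hi, hd, Option.map_some, Option.map_none, hr, hb, toStandard, if_true,
        hsi.symm, hsd.symm, hid.symm, if_false]
    · exact (far_potRBNDB hB (.S, .red) (by decide)).mono (by simp only [potRBNDB, dDiff]; omega)
    · exact (far_potRBNDB hB (.I, .blue) (by decide)).mono (by simp only [potRBNDB, dSame]; omega)
    · exact (far_potRBNDB hB (.D, .red) (by decide)).mono (by simp only [potRBNDB, dTurn]; omega)
    · exact (far_potRBNIB hB (.S, .red) (by decide)).mono (by simp only [potRBNIB, dFixed]; omega)
  intro pre s i d a hsi hsd hid hs hi hd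
  obtain ⟨h1, h2, h3, h4⟩ := key pre s i d a hsi hsd hid hs hi hd
  obtain ⟨k1, k2, -, -⟩ := key pre i s d a.flip hsi.symm hid hsd hi (by simpa using hs) hd
  rw [Colour.flip_flip] at k1 k2
  have as : Allows pre (s, a) := Or.inr hs
  have ai : Allows pre (i, a.flip) := Or.inr hi
  have ad : ∀ c, Allows pre (d, c) := fun _ => Or.inl hd
  have hall : ∀ x, Allows pre x →
      x = (s, a) ∨ x = (i, a.flip) ∨ x = (d, a) ∨ x = (d, a.flip) := by
    rintro ⟨p, c⟩ hx
    rcases eq_or_eq_or_eq hsi hsd hid p with rfl | rfl | rfl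
    · simp [← eq_of_allows_some hx hs]
    · simp [← eq_of_allows_some hx hi]
    · by_cases hc : c = a
      · simp [hc]
      · simp [Colour.eq_flip_of_ne hc]
  have hf := Colour.flip_ne a
  intro x y hx hy
  rcases hall x hx with rfl | rfl | rfl | rfl <;> rcases hall y hy with rfl | rfl | rfl | rfl <;>
    simp only [distNeutral, Prod.mk.injEq, hsi, hsi.symm, hsd, hsd.symm, hid, hid.symm,
      if_true, if_false, and_self, hf, hf.symm, ne_eq, not_true, not_false_eq_true,
      and_false, and_true] <;>
    first
    | exact far_zero _ _ _ _
    | exact h1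
    | exact h2
    | exact h3
    | exact h4
    | exact k1
    | exact k2
    | exact h1.symm hx
    | exact h2.symm hx
    | exact h3.symm hx
    | exact h4.symm hx
    | exact k1.symm hx
    | exact k2.symm hx

theorem farNeutral (n : ℕ) : FarNeutral n := by
  induction n with
  | zero =>
    intro pre s i d a _ _ _ _ _ _ x y _ _
    have : distNeutral 0 d x y = 0 := by simp [distNeutral, dTurn, dFixed, dSame, dDiff]
    rw [this]
    exact far_zero _ _ _ _
  | succ n ih => exact ih.succ

-- Distances with two neutral posts.

/-- In the pre-colouring RNN: the number of moves to the tower on the Destination, blue up, from the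
arrangement with the biggest disk as told by the first argument and the `n` smaller disks stacked
as told by the second. -/
def potRNNDB (n : ℕ) : Post × Colour → Post × Colour → ℕ
  | (.D, .blue), (.S, .red) => dFixed n
  | (.D, .blue), (.I, .red) => dDiff n
  | (.D, .blue), (.I, .blue) => dSame n
  | (.D, .blue), (.D, .blue) => 0
  | (.S, .red), (.S, .red) => dSame n + eDiff n + 1
  | (.S, .red), (.I, .red) => dDiff n + 1
  | (.S, .red), (.I, .blue) => dSame n + 1
  | (.S, .red), (.D, .red) => dDiff n + dSame n + 1
  | (.S, .red), (.D, .blue) => 2 * dDiff n + 1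
  | (.I, .red), (.S, .red) => dFixed n + 1
  | (.I, .red), (.I, .red) => 2 * dAdj n + dFixed n + 1
  | (.I, .red), (.D, .blue) => dAdj n + dFixed n + 1
  | (.I, .blue), (.S, .red) => 3 * dDiff n + 2
  | (.I, .blue), (.I, .blue) => 2 * dDiff n + dSame n + 2
  | (.I, .blue), (.D, .red) => dDiff n + dSame n + 2
  | (.I, .blue), (.D, .blue) => 2 * dDiff n + 2
  | (.D, .red), (.S, .red) => 3 * dDiff n + 3
  | (.D, .red), (.I, .blue) => dAdj n + 3 * dDiff n + 3
  | (.D, .red), (.D, .red) => 2 * dAdj n + 3 * dDiff n + 3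
  -- Besides forbidden arrangements, this covers the biggest disk red on one neutral post and a red
  -- tower on the other. Such a tower is locked, since its disks would turn blue on moving and both
  -- other posts demand red.
  | _, _ => 0

/-- In the pre-colouring RNN: the number of moves to the tower on the Destination, red up, from the
arrangement with the biggest disk as told by the first argument and the `n` smaller disks stacked
as told by the second. -/
def potRNNDR (n : ℕ) : Post × Colour → Post × Colour → ℕ
  | (.D, .red), (.S, .red) => 2 * dAdj n
  | (.D, .red), (.I, .blue) => dAdj n
  | (.D, .red), (.D, .red) => 0
  | (.I, .blue), (.S, .red) => 2 * dAdj n + 1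
  | (.I, .blue), (.I, .blue) => 2 * dAdj n + dFixed n + 1
  | (.I, .blue), (.D, .red) => 2 * dAdj n + dSame n + 1
  | (.I, .blue), (.D, .blue) => 2 * dAdj n + dDiff n + 1
  | (.S, .red), (.S, .red) => 2 * dAdj n + dDiff n + eDiff n + 2
  | (.S, .red), (.I, .red) => 2 * dAdj n + 2 * dDiff n + 2
  | (.S, .red), (.I, .blue) => 2 * dAdj n + dDiff n + eOther n + 2
  | (.S, .red), (.D, .red) => 2 * dAdj n + dSame n + 2
  | (.S, .red), (.D, .blue) => 2 * dAdj n + dDiff n + 2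
  | (.D, .blue), (.S, .red) => 2 * dAdj n + 2 * dDiff n + eOther n + 3
  | (.D, .blue), (.I, .red) => 2 * dAdj n + 2 * dDiff n + 3
  | (.D, .blue), (.I, .blue) => 2 * dAdj n + dDiff n + eOther n + 3
  | (.D, .blue), (.D, .blue) => 2 * dAdj n + 3 * dDiff n + 3
  | (.I, .red), (.S, .red) => 2 * dAdj n + 2 * dDiff n + eOther n + 4
  | (.I, .red), (.I, .red) => 4 * dAdj n + 2 * dDiff n + eOther n + 4
  | (.I, .red), (.D, .blue) => 3 * dAdj n + 2 * dDiff n + eOther n + 4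
  | _, _ => 0



theorem far_of_neutral_and_alike {pre : PreColouring} {n : ℕ} {s i d : Post} {a : Colour}
    (hsi : s ≠ i) (hsd : s ≠ d) (hid : i ≠ d) (hs : pre s = some a) (hi : pre i = some a)
    {x y : Post × Colour} (hx : Allows (pin pre (d, a.flip)) x)
    (hy : Allows (pin pre (d, a.flip)) y) : Far pre n x y (distCol n d x y) := by
  have hp : ∀ p, p ≠ d → pre p = some a := by
    intro p hpd
    rcases eq_or_eq_or_eq hsi hsd hid p with rfl | rfl | rfl
    · exact hs
    · exact hi
    · exact absurd rfl hpd
  intro L hL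
  refine farCol n (pin pre (d, a.flip)) d s i a.flip hsd.symm hid.symm hsi (by simp [pin])
    (by simp [pin, hsd, hs]) (by simp [pin, hid, hi]) x y hx hy L ?_
  exact hL.pin_of_neutral hp (valid_tower hx)

/-- The lower bound for the distances of towers with two neutral posts. -/
def FarNeutral₂ (n : ℕ) : Prop := ∀ (pre : PreColouring) (s i d : Post) (a : Colour),
  s ≠ i → s ≠ d → i ≠ d → pre s = some a → pre i = none → pre d = none →
  ∀ x y, Allows pre x → Allows pre y → Far pre n x y (distNeutral₂ n s a x y)

/-- Distances between towers of `n` disks in the pre-colouring RNN, a bigger disk lying as told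
by the first argument. -/
def distRNN (n : ℕ) : Post × Colour → Post × Colour → Post × Colour → ℕ
  | (.I, .blue) => distNeutral n .D
  | (.D, .blue) => distNeutral n .I
  | (.I, .red) => fun x y => if x = (.D, .red) ∨ y = (.D, .red) then 0 else distCol n .D x y
  | (.D, .red) => fun x y => if x = (.I, .red) ∨ y = (.I, .red) then 0 else distCol n .I x y
  | (.S, _) => distNeutral₂ n .S .red

def FarBelowRNN (n : ℕ) : Prop := ∀ b s r, Allows RNN b → Allows (pin RNN b) s →
  Allows (pin RNN b) r → Far (pin RNN b) n s r (distRNN n b s r)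

theorem FarNeutral₂.farBelowRNN {n : ℕ} (h : FarNeutral₂ n) : FarBelowRNN n := by
  intro b s r
  revert b
  refine forall_post_colour ?_ ?_ ?_ ?_ ?_ ?_ <;> intro hb
  · exact h _ .S .I .D .red (by decide) (by decide) (by decide) rfl rfl rfl s r
  · exact absurd hb (by decide)
  · intro hs hr
    -- With the biggest disk red on I, a red tower on D is locked, and the trivial bound suffices.
    -- All other towers also fit a blue D.
    by_cases hsr : s = (.D, .red) ∨ r = (.D, .red)
    · simp only [distRNN, hsr, if_true]
      exact far_zero _ _ _ _
    · simp only [distRNN, hsr, if_false]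
      rw [not_or] at hsr
      refine far_of_neutral_and_alike (s := .S) (i := .I) (a := .red) (by decide) (by decide)
        (by decide) rfl rfl ?_ ?_
      · revert s; refine forall_post_colour ?_ ?_ ?_ ?_ ?_ ?_ <;> simp +decide
      · revert r; refine forall_post_colour ?_ ?_ ?_ ?_ ?_ ?_ <;> simp +decide
  · exact farNeutral n _ .S .I .D .red (by decide) (by decide) (by decide) rfl rfl rfl s r
  · intro hs hr
    by_cases hsr : s = (.I, .red) ∨ r = (.I, .red)
    · simp only [distRNN, hsr, if_true]
      exact far_zero _ _ _ _
    · simp only [distRNN, hsr, if_false]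
      rw [not_or] at hsr
      refine far_of_neutral_and_alike (s := .S) (i := .D) (a := .red) (by decide) (by decide)
        (by decide) rfl rfl ?_ ?_
      · revert s; refine forall_post_colour ?_ ?_ ?_ ?_ ?_ ?_ <;> simp +decide
      · revert r; refine forall_post_colour ?_ ?_ ?_ ?_ ?_ ?_ <;> simp +decide
  · exact farNeutral n _ .S .D .I .red (by decide) (by decide) (by decide) rfl rfl rfl s r

theorem far_potRNNDB {n : ℕ} (h : FarBelowRNN n) (x : Post × Colour)
    (hx : Allows RNN x) : Far RNN (n + 1) x (.D, .blue) (potRNNDB n x x) := by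
  refine far_of_potential (distRNN n) _ hx h ?_ ?_ (by decide)
  · refine forall_post_colour ?_ ?_ ?_ ?_ ?_ ?_ <;> intro h <;>
    first
    | exact absurd h (by decide)
    | simp [potRNNDB, distRNN, distNeutral]
  · have hd := d_inequalities n
    have he := e_inequalities n
    refine forall_post_colour ?_ ?_ ?_ ?_ ?_ ?_ <;>
    refine forall_post_colour ?_ ?_ ?_ ?_ ?_ ?_ <;>
    intro p' r e h1 h2 h3 h4 h5 h6 h7 <;>
    first
    | exact absurd h1 (by decide)
    | exact absurd h2 (by decide)
    | (cases p' <;> first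
        | exact absurd h3 (by decide)
        | exact absurd h6 (by decide)
        | (cases r <;> first
            | exact absurd h4 (by decide)
            | exact absurd h5 (by decide)
            | (cases e <;> first
              | exact absurd h7 (by decide)
              | (simp [potRNNDB, distRNN, distCol, distNeutral, distNeutral₂, Colour.flip]
                 try omega))))

theorem far_potRNNDR {n : ℕ} (h : FarBelowRNN n) (x : Post × Colour)
    (hx : Allows RNN x) : Far RNN (n + 1) x (.D, .red) (potRNNDR n x x) := by
  refine far_of_potential (distRNN n) _ hx h ?_ ?_ (by decide)
  · refine forall_post_colour ?_ ?_ ?_ ?_ ?_ ?_ <;> intro h <;>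
    first
    | exact absurd h (by decide)
    | simp [potRNNDR, distRNN, distCol]
  · have hd := d_inequalities n
    have he := e_inequalities n
    refine forall_post_colour ?_ ?_ ?_ ?_ ?_ ?_ <;>
    refine forall_post_colour ?_ ?_ ?_ ?_ ?_ ?_ <;>
    intro p' r e h1 h2 h3 h4 h5 h6 h7 <;>
    first
    | exact absurd h1 (by decide)
    | exact absurd h2 (by decide)
    | (cases p' <;> first
        | exact absurd h3 (by decide)
        | exact absurd h6 (by decide)
        | (cases r <;> first
            | exact absurd h4 (by decide)
            | exact absurd h5 (by decide)
            | (cases e <;> first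
              | exact absurd h7 (by decide)
              | (simp [potRNNDR, distRNN, distCol, distNeutral, distNeutral₂, Colour.flip]
                 try omega))))

/-- Up to exchanging the neutral posts and reversing time there are six pairs of distinct towers:
four end with `a.flip` up on `d`, two with `a` up. -/
theorem FarNeutral₂.succ {n : ℕ} (h : FarNeutral₂ n) : FarNeutral₂ (n + 1) := by
  have key : ∀ (pre : PreColouring) (s i d : Post) (a : Colour),
      s ≠ i → s ≠ d → i ≠ d → pre s = some a → pre i = none → pre d = none →
      Far pre (n + 1) (s, a) (d, a.flip) (eDiff (n + 1)) ∧
      Far pre (n + 1) (i, a) (d, a.flip) (dDiff (n + 1)) ∧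
      Far pre (n + 1) (i, a.flip) (d, a.flip) (eOther (n + 1)) ∧
      Far pre (n + 1) (d, a) (d, a.flip) (eTurn (n + 1)) ∧
      Far pre (n + 1) (s, a) (d, a) (eSame (n + 1)) ∧
      Far pre (n + 1) (i, a) (d, a) (eOwn (n + 1)) := by
    intro pre s i d a hsi hsd hid hs hi hd
    have hr : toRed a a = .red := by simp [toRed]
    have hb : toRed a a.flip = .blue := by simp [toRed, Colour.flip_ne]
    have hB := h.farBelowRNN
    refine ⟨?_, ?_, ?_, ?_, ?_, ?_⟩ <;> apply Far.of_standard (a := a) hsi hsd hid <;>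
      simp only [hs, hi, hd, Option.map_some, Option.map_none, hr, hb, toStandard, if_true,
        hsi.symm, hsd.symm, hid.symm, if_false]
    · exact (far_potRNNDB hB (.S, .red) (by decide)).mono (by simp only [potRNNDB, eDiff]; omega)
    · exact (far_potRNNDB hB (.I, .red) (by decide)).mono (by simp only [potRNNDB, dDiff]; omega)
    · exact (far_potRNNDB hB (.I, .blue) (by decide)).mono (by
        simp only [potRNNDB, eOther]; omega)
    · exact (far_potRNNDB hB (.D, .red) (by decide)).mono (by simp only [potRNNDB, eTurn]; omega)
    · exact (far_potRNNDR hB (.S, .red) (by decide)).mono (by simp only [potRNNDR, eSame]; omega)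
    · exact (far_potRNNDR hB (.I, .red) (by decide)).mono (by simp only [potRNNDR, eOwn]; omega)
  intro pre s i d a hsi hsd hid hs hi hd
  obtain ⟨h1, h2, h3, h4, h5, h6⟩ := key pre s i d a hsi hsd hid hs hi hd
  obtain ⟨k1, k2, k3, k4, k5, k6⟩ := key pre s d i a hsd hsi hid.symm hs hd hi
  have hall : ∀ x, Allows pre x →
      x = (s, a) ∨ x = (i, a) ∨ x = (i, a.flip) ∨ x = (d, a) ∨ x = (d, a.flip) := by
    rintro ⟨p, c⟩ hx
    rcases eq_or_eq_or_eq hsi hsd hid p with rfl | rfl | rfl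
    · simp [← eq_of_allows_some hx hs]
    · by_cases hc : c = a
      · simp [hc]
      · simp [Colour.eq_flip_of_ne hc]
    · by_cases hc : c = a
      · simp [hc]
      · simp [Colour.eq_flip_of_ne hc]
  have hf := Colour.flip_ne a
  intro x y hx hy
  rcases hall x hx with rfl | rfl | rfl | rfl | rfl <;>
  rcases hall y hy with rfl | rfl | rfl | rfl | rfl <;>
    simp only [distNeutral₂, Prod.mk.injEq, hsi, hsi.symm, hsd, hsd.symm, hid, hid.symm,
      if_true, if_false, and_self, hf, hf.symm, ne_eq, not_true, not_false_eq_true,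
      and_false, and_true, true_or, or_true, or_self] <;>
    first
    | exact far_zero _ _ _ _
    | assumption
    | exact h1.symm hx
    | exact h2.symm hx
    | exact h3.symm hx
    | exact h4.symm hx
    | exact h5.symm hx
    | exact h6.symm hx
    | exact k1.symm hx
    | exact k2.symm hx
    | exact k4.symm hx
    | exact k5.symm hx

theorem farNeutral₂ (n : ℕ) : FarNeutral₂ n := by
  induction n with
  | zero =>
    intro pre s i d a _ _ _ _ _ _ x y _ _
    have : distNeutral₂ 0 s a x y = 0 := by
      simp [distNeutral₂, dDiff, eTurn, eSame, eDiff, eOwn, eOther]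
    rw [this]
    exact far_zero _ _ _ _
  | succ n ih => exact ih.succ

open Filter Topology

/-! The numbers of moves of the disks with a property `P`. -/

mutual

/-- The number of moves in `SRBB1000 n` of disks with property `P`. -/
def count1000 (P : ℕ → Bool) : ℕ → ℕ
  | 0 => 0
  | n + 1 => 3 * count1000 P n + (P n).toNat

/-- The number of moves in `SRBN909 n` of disks with property `P`. -/
def count909 (P : ℕ → Bool) : ℕ → ℕ
  | 0 => 0
  | n + 1 => count727 P n + 2 * count1000 P n + (P n).toNat

/-- The number of moves in `SRNB727 n` of disks with property `P`. -/
def count727 (P : ℕ → Bool) : ℕ → ℕ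
  | 0 => 0
  | 1 => (P 0).toNat
  | n + 2 => count909 P (n + 1) + 2 * count1000 P n + 2 * count909 P n + 2 * (P n).toNat +
      (P (n + 1)).toNat

end

/-- The number of moves in `SRNN636 n` of disks with property `P`. -/
def count636 (P : ℕ → Bool) : ℕ → ℕ
  | 0 => 0
  | 1 => (P 0).toNat
  | n + 2 => count636 P (n + 1) + 2 * count1000 P n + 2 * count909 P n + 2 * (P n).toNat +
      (P (n + 1)).toNat

theorem countP_singleton_disk (P : ℕ → Bool) (n : ℕ) (s d : Post) :
    List.countP (fun m => P m.disk) [(⟨n, s, d⟩ : Move)] = (P n).toNat := by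
  cases h : P n <;> simp [h]

theorem countP_1000 (P : ℕ → Bool) (n : ℕ) : ∀ s d i : Post,
    (SRBB1000 n s d i).countP (fun m => P m.disk) = count1000 P n ∧
    (SRRB1000 n s d i).countP (fun m => P m.disk) = count1000 P n := by
  induction n with
  | zero => simp [SRBB1000, SRRB1000, count1000]
  | succ n ih =>
    intro s d i
    simp only [SRBB1000, SRRB1000, count1000, List.countP_append, countP_singleton_disk, ih]
    omega

theorem countP_909_727 (P : ℕ → Bool) (n : ℕ) : ∀ s d i : Post,
    (SRBN909 n s d i).countP (fun m => P m.disk) = count909 P n ∧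
    (SNRB909 n s d i).countP (fun m => P m.disk) = count909 P n ∧
    (SRNB727 n s d i).countP (fun m => P m.disk) = count727 P n ∧
    (SBNR727 n s d i).countP (fun m => P m.disk) = count727 P n := by
  induction n using Nat.strong_induction_on with
  | _ n ih =>
  intro s d i
  rcases n with _ | _ | n
  · simp [SRBN909, SNRB909, SRNB727, SBNR727, count909, count727]
  · simp only [zero_add, SRBN909, SNRB909, SRNB727, SBNR727, count909, count727,
      List.countP_append, countP_singleton_disk, countP_1000, List.countP_nil, and_self, and_true]
    omega
  · have h1 := ih n (by omega)
    have h2 := ih (n + 1) (by omega)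
    refine ⟨?_, ?_, ?_, ?_⟩
    · rw [SRBN909, count909]
      simp only [List.countP_append, countP_singleton_disk, countP_1000, h2]
      omega
    · rw [SNRB909, count909]
      simp only [List.countP_append, countP_singleton_disk, countP_1000, h2]
      omega
    · rw [SRNB727, count727]
      simp only [List.countP_append, countP_singleton_disk, countP_1000, h1, h2]
      omega
    · rw [SBNR727, count727]
      simp only [List.countP_append, countP_singleton_disk, countP_1000, h1, h2]
      omega

theorem countP_636 (P : ℕ → Bool) (n : ℕ) : ∀ s d i : Post,
    (SRNN636 n s d i).countP (fun m => P m.disk) = count636 P n ∧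
    (SNNB636 n s d i).countP (fun m => P m.disk) = count636 P n := by
  induction n with
  | zero => simp [SRNN636, SNNB636, count636]
  | succ n ih =>
    intro s d i
    rcases n with _ | n
    · simp only [SRNN636, SNNB636, count636, countP_singleton_disk, and_self]
    · simp only [SRNN636, SNNB636, count636, List.countP_append, countP_singleton_disk,
        countP_1000, countP_909_727, ih]
      omega

/-- An additional smallest disk shifts all labels by one and leaves the moves of the larger disks as
they were. The recurrences reach back two levels, hence strong induction. -/
theorem count_succ_succ (j n : ℕ) :
    count1000 (· = j + 1) (n + 1) = count1000 (· = j) n ∧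
    count909 (· = j + 1) (n + 1) = count909 (· = j) n ∧
    count727 (· = j + 1) (n + 1) = count727 (· = j) n ∧
    count636 (· = j + 1) (n + 1) = count636 (· = j) n := by
  induction n using Nat.strong_induction_on with
  | _ n ih =>
  rcases n with _ | _ | n
  · simp [count1000, count909, count727, count636]
  · simp [count1000, count909, count727, count636, eq_comm]
  · obtain ⟨h1, h2, h3, h4⟩ := ih n (by omega)
    obtain ⟨k1, k2, k3, k4⟩ := ih (n + 1) (by omega)
    refine ⟨?_, ?_, ?_, ?_⟩
    · conv_lhs => rw [count1000, k1]
      conv_rhs => rw [count1000]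
      simp
    · conv_lhs => rw [count909, k1, k3]
      conv_rhs => rw [count909]
      simp
    · conv_lhs => rw [count727, k2, h1, h2]
      conv_rhs => rw [count727]
      simp
    · conv_lhs => rw [count636, k4, h1, h2]
      conv_rhs => rw [count636]
      simp

theorem count_sub (m k : ℕ) :
    count1000 (· = m) (k + m) = count1000 (· = 0) k ∧
    count909 (· = m) (k + m) = count909 (· = 0) k ∧
    count636 (· = m) (k + m) = count636 (· = 0) k := by
  induction m with
  | zero => simp
  | succ m ih =>
    obtain ⟨h1, h2, -, h4⟩ := count_succ_succ m (k + m)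
    exact ⟨h1.trans ih.1, h2.trans ih.2.1, h4.trans ih.2.2⟩

theorem diskMoves_eq_countP (alg : ℕ → Post → Post → Post → List Move) (N k : ℕ) :
    diskMoves alg N k = (alg N .S .D .I).countP (fun m => decide (m.disk = N - k)) :=
  List.countP_eq_length_filter.symm

theorem totalMoves_eq_countP (alg : ℕ → Post → Post → Post → List Move) (N : ℕ) :
    totalMoves alg N = (alg N .S .D .I).countP (fun m => (fun _ : ℕ => true) m.disk) := by
  simp [totalMoves]

theorem diskMoves_1000 {N k : ℕ} (h : k ≤ N) :
    diskMoves SRBB1000 N k = count1000 (· = 0) k ∧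
    diskMoves SRRB1000 N k = count1000 (· = 0) k := by
  obtain ⟨m, rfl⟩ := Nat.exists_eq_add_of_le h
  have h1 := countP_1000 (fun x => decide (x = m)) (k + m) .S .D .I
  rw [(count_sub m k).1] at h1
  simpa only [diskMoves_eq_countP, Nat.add_sub_cancel_left] using h1

theorem diskMoves_909 {N k : ℕ} (h : k ≤ N) :
    diskMoves SRBN909 N k = count909 (· = 0) k ∧
    diskMoves SNRB909 N k = count909 (· = 0) k := by
  obtain ⟨m, rfl⟩ := Nat.exists_eq_add_of_le h
  have h1 := countP_909_727 (fun x => decide (x = m)) (k + m) .S .D .I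
  rw [(count_sub m k).2.1] at h1
  simpa only [diskMoves_eq_countP, Nat.add_sub_cancel_left] using And.intro h1.1 h1.2.1

theorem diskMoves_636 {N k : ℕ} (h : k ≤ N) :
    diskMoves SRNN636 N k = count636 (· = 0) k ∧
    diskMoves SNNB636 N k = count636 (· = 0) k := by
  obtain ⟨m, rfl⟩ := Nat.exists_eq_add_of_le h
  have h1 := countP_636 (fun x => decide (x = m)) (k + m) .S .D .I
  rw [(count_sub m k).2.2] at h1
  simpa only [diskMoves_eq_countP, Nat.add_sub_cancel_left] using h1

theorem count1000_true (n : ℕ) : count1000 (fun _ => true) n = dAdj n := by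
  induction n with
  | zero => simp [count1000, dAdj]
  | succ n ih => simp [count1000, dAdj, ih]

/-- The move counts satisfy the recurrences of the lower bounds; the 727 count is `dFixed` with
`dSame` unfolded once. -/
theorem count909_727_true (n : ℕ) :
    count909 (fun _ => true) n = dDiff n ∧ count727 (fun _ => true) n = dFixed n := by
  induction n using Nat.strong_induction_on with
  | _ n ih =>
  rcases n with _ | _ | n
  · simp [count909, count727, dDiff, dFixed]
  · simp [count909, count727, count1000, dDiff, dFixed, dAdj, dSame]
  · have h1 := ih n (by omega)
    have h2 := ih (n + 1) (by omega)
    constructor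
    · rw [count909, h2.2, count1000_true, dDiff]; simp
    · rw [count727, h2.1, h1.1, count1000_true, dFixed, dSame]; simp; omega

theorem count636_true (n : ℕ) : count636 (fun _ => true) n = eDiff n := by
  induction n with
  | zero => simp [count636, eDiff]
  | succ n ih =>
    rcases n with _ | n
    · simp [count636, eDiff, dSame]
    · rw [count636, ih, (count909_727_true n).1, count1000_true]
      simp only [eDiff, dSame, Bool.toNat_true]
      omega

theorem totalMoves_1000 (N : ℕ) :
    totalMoves SRBB1000 N = dAdj N ∧ totalMoves SRRB1000 N = dAdj N := by
  rw [totalMoves_eq_countP, totalMoves_eq_countP, ← count1000_true]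
  exact countP_1000 (fun _ => true) N _ _ _

theorem totalMoves_909 (N : ℕ) :
    totalMoves SRBN909 N = dDiff N ∧ totalMoves SNRB909 N = dDiff N := by
  rw [totalMoves_eq_countP, totalMoves_eq_countP, ← (count909_727_true N).1]
  have h := countP_909_727 (fun _ => true) N .S .D .I
  exact ⟨h.1, h.2.1⟩

theorem totalMoves_636 (N : ℕ) :
    totalMoves SRNN636 N = eDiff N ∧ totalMoves SNNB636 N = eDiff N := by
  rw [totalMoves_eq_countP, totalMoves_eq_countP, ← count636_true]
  exact countP_636 (fun _ => true) N _ _ _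

theorem isOptimal_SRNN636 (N : ℕ) : IsOptimal RNN N (SRNN636 N .S .D .I) := by
  refine ⟨carries_SRNN636 N RNN .S .D .I .red (by decide) (by decide) (by decide) (by decide)
    (by decide) (by decide) (by decide) (by decide), fun L hL => ?_⟩
  have := farNeutral₂ N RNN .S .I .D .red (by decide) (by decide) (by decide) rfl rfl rfl
    (.S, .red) (.D, .blue) (by decide) (by decide) L hL
  exact (totalMoves_636 N).1.trans_le this

/-- The distance bound is symmetric in its endpoints, so it applies with the coloured post D and the
colour blue in the leading role. -/
theorem isOptimal_SNNB636 (N : ℕ) : IsOptimal NNB N (SNNB636 N .S .D .I) := by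
  refine ⟨carries_SNNB636 N NNB .S .D .I .red (by decide) (by decide) (by decide) (by decide)
    (by decide) (by decide) (by decide) (by decide), fun L hL => ?_⟩
  have := farNeutral₂ N NNB .D .I .S .blue (by decide) (by decide) (by decide) rfl rfl rfl
    (.S, .red) (.D, .blue) (by decide) (by decide) L hL
  exact (totalMoves_636 N).2.trans_le this

-- Asymptotics.

theorem two_mul_dAdj_add_one (n : ℕ) : 2 * dAdj n + 1 = 3 ^ n := by
  induction n with
  | zero => simp [dAdj]
  | succ n ih => rw [dAdj, pow_succ, ← ih]; ring

/-- Since `2 * dAdj n + 1` is 3 ^ n, substituting multiples of 3 ^ n into the recurrences gives the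
coefficients 5/11, 4/11 and 7/11. The factors 11 and 22 are chosen so that the three error bounds
reproduce themselves with ratio 2. -/
theorem abs_dDiff_sub_le (n : ℕ) :
    |(11 * dDiff n - 5 * 3 ^ n : ℤ)| ≤ 11 * 2 ^ n ∧
    |(11 * dFixed n - 4 * 3 ^ n : ℤ)| ≤ 22 * 2 ^ n ∧
    |(11 * dSame n - 7 * 3 ^ n : ℤ)| ≤ 22 * 2 ^ n := by
  induction n with
  | zero => simp [dDiff, dFixed, dSame]
  | succ n ih =>
    have h : (2 * dAdj n + 1 : ℤ) = 3 ^ n := by exact_mod_cast two_mul_dAdj_add_one n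
    have h2 : (1 : ℤ) ≤ 2 ^ n := one_le_pow₀ (by norm_num)
    simp only [dDiff, dFixed, dSame, pow_succ, abs_le] at ih ⊢
    push_cast
    refine ⟨⟨?_, ?_⟩, ⟨?_, ?_⟩, ⟨?_, ?_⟩⟩ <;> linarith

theorem abs_eDiff_sub_le (n : ℕ) : |(22 * eDiff n - 7 * 3 ^ n : ℤ)| ≤ 66 * 2 ^ n := by
  induction n with
  | zero => simp [eDiff]
  | succ n ih =>
    obtain ⟨-, -, hs⟩ := abs_dDiff_sub_le n
    have h2 : (1 : ℤ) ≤ 2 ^ n := one_le_pow₀ (by norm_num)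
    simp only [eDiff, pow_succ, abs_le] at ih hs ⊢
    push_cast
    constructor <;> linarith

theorem tendsto_eDiff_div_dAdj :
    Tendsto (fun n : ℕ => (eDiff n : ℝ) / (dAdj n : ℝ)) atTop (𝓝 (7 / 11)) := by
  have h23 : Tendsto (fun n : ℕ => (2 / 3 : ℝ) ^ n) atTop (𝓝 0) :=
    tendsto_pow_atTop_nhds_zero_of_lt_one (by norm_num) (by norm_num)
  have h13 : Tendsto (fun n : ℕ => (1 / 3 : ℝ) ^ n) atTop (𝓝 0) :=
    tendsto_pow_atTop_nhds_zero_of_lt_one (by norm_num) (by norm_num)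
  have hnum : Tendsto (fun n : ℕ => (eDiff n : ℝ) / 3 ^ n) atTop (𝓝 (7 / 22)) := by
    rw [tendsto_iff_norm_sub_tendsto_zero]
    -- The constant 3 is 66 / 22, from `abs_eDiff_sub_le`.
    refine squeeze_zero (fun _ => norm_nonneg _) (fun n => ?_) (by simpa using h23.const_mul 3)
    have h : |(22 * eDiff n - 7 * 3 ^ n : ℝ)| ≤ 66 * 2 ^ n := by
      exact_mod_cast abs_eDiff_sub_le n
    have h3 : (0 : ℝ) < 3 ^ n := by positivity
    rw [show (eDiff n : ℝ) / 3 ^ n - 7 / 22 = (22 * eDiff n - 7 * 3 ^ n) / (22 * 3 ^ n) by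
      field_simp, Real.norm_eq_abs, abs_div, abs_of_pos (by positivity : (0 : ℝ) < 22 * 3 ^ n),
      div_pow, div_le_iff₀ (by positivity)]
    calc _ ≤ _ := h
      _ = _ := by field_simp; norm_num
  have hden : Tendsto (fun n : ℕ => (dAdj n : ℝ) / 3 ^ n) atTop (𝓝 (1 / 2)) := by
    have h := (h13.const_sub 1).div_const 2
    rw [sub_zero] at h
    refine h.congr fun n => ?_
    have h1 : (2 * dAdj n + 1 : ℝ) = 3 ^ n := by exact_mod_cast two_mul_dAdj_add_one n
    have h3 : (0 : ℝ) < 3 ^ n := by positivity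
    rw [div_pow, one_pow]
    field_simp
    linarith
  have h := hnum.div hden (by norm_num)
  rw [show (7 / 22 / (1 / 2) : ℝ) = 7 / 11 by norm_num] at h
  refine h.congr fun n => ?_
  exact div_div_div_cancel_right₀ (by positivity) _ _

end MToH

open MToH Filter Topology in
theorem mainTheorem4 :
    -- the "636" algorithms solve their puzzles in the least possible number of moves
    (∀ N : ℕ, IsOptimal RNN N (SRNN636 N .S .D .I)) ∧
    (∀ N : ℕ, IsOptimal NNB N (SNNB636 N .S .D .I)) ∧
    -- both members of a pair make the same total number of moves
    (∀ N : ℕ, totalMoves SNNB636 N = S636 N ∧ totalMoves SNRB909 N = S909 N ∧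
      totalMoves SRRB1000 N = S1000 N) ∧
    -- recurrence for the total number of moves
    S636 1 = 1 ∧ S636 2 = 4 ∧
    (∀ N : ℕ, 1 ≤ N →
      S636 (N + 1) = S636 N + 2 * S909 (N - 1) + 2 * S1000 (N - 1) + 3) ∧
    -- the number of moves of disk `k` depends neither on the number of disks in the tower nor
    -- on the member of the pair
    (∀ N k : ℕ, 1 ≤ k → k ≤ N →
      diskMoves SRNN636 N k = P636 k ∧ diskMoves SNNB636 N k = P636 k ∧
      diskMoves SRBN909 N k = P909 k ∧ diskMoves SNRB909 N k = P909 k ∧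
      diskMoves SRBB1000 N k = P1000 k ∧ diskMoves SRRB1000 N k = P1000 k) ∧
    -- recurrence for the number of moves of a single disk
    P636 1 = 1 ∧ P636 2 = 3 ∧
    (∀ k : ℕ, 2 ≤ k →
      P636 (k + 1) = P636 k + 2 * P909 (k - 1) + 2 * P1000 (k - 1)) ∧
    -- the duration limit
    Tendsto (fun N : ℕ => (S636 N : ℝ) / (S1000 N : ℝ)) atTop (𝓝 (7 / 11)) := by
  have hS636 : ∀ n, S636 n = eDiff n := fun n => (totalMoves_636 n).1
  have hS909 : ∀ n, S909 n = dDiff n := fun n => (totalMoves_909 n).1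
  have hS1000 : ∀ n, S1000 n = dAdj n := fun n => (totalMoves_1000 n).1
  have hP636 : ∀ k, P636 k = count636 (· = 0) k := fun k => (diskMoves_636 le_rfl).1
  have hP909 : ∀ k, P909 k = count909 (· = 0) k := fun k => (diskMoves_909 le_rfl).1
  have hP1000 : ∀ k, P1000 k = count1000 (· = 0) k := fun k => (diskMoves_1000 le_rfl).1
  refine ⟨isOptimal_SRNN636, isOptimal_SNNB636, fun N => ?_, ?_, ?_, fun N hN => ?_,
    fun N k _ hk => ?_, ?_, ?_, fun k hk => ?_, ?_⟩
  · rw [hS636, hS909, hS1000]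
    exact ⟨(totalMoves_636 N).2, (totalMoves_909 N).2, (totalMoves_1000 N).2⟩
  · simp [hS636, eDiff, dSame]
  · simp [hS636, eDiff, dSame, dAdj, dDiff]
  · obtain ⟨n, rfl⟩ := Nat.exists_eq_add_of_le' hN
    simp only [hS636, hS909, hS1000, Nat.add_sub_cancel]
    rw [eDiff, dSame]
    omega
  · rw [hP636, hP909, hP1000]
    exact ⟨(diskMoves_636 hk).1, (diskMoves_636 hk).2, (diskMoves_909 hk).1, (diskMoves_909 hk).2,
      (diskMoves_1000 hk).1, (diskMoves_1000 hk).2⟩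
  · simp [hP636, count636]
  · simp [hP636, count636, count909, count1000]
  · obtain ⟨n, rfl⟩ : ∃ n, k = n + 1 + 1 := ⟨k - 2, by omega⟩
    simp only [hP636, hP909, hP1000, Nat.add_sub_cancel]
    rw [count636]
    simp
    omega
  · simpa only [hS636, hS1000] using tendsto_eDiff_div_dAdj
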